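/- Let $N\ge 1$ and let $S\in\{0,\tfrac12,1,\tfrac32,\dots\}$. Place $N$ spins of size $S$ on the sites $\eta_\alpha=e^{2\pi i\alpha/N}$, $\alpha=1,\dots,N$, of the unit circle, let $\boldsymbol S_\alpha=(S^x_\alpha,S^y_\alpha,S^z_\alpha)$ be the spin operators (spin-$S$ representation, $\boldsymbol S_\alpha^2=S(S+1)$) acting on site $\alpha$ of $(\mathbb C^{2S+1})^{\otimes N}$, and let $\boldsymbol S_{\rm tot}=\sum_\alpha\boldsymbol S_\alpha$. Define the vector operators $$\boldsymbol D_\alpha=\frac12\sum_{\beta\ne\alpha}\frac{\eta_\alpha+\eta_\beta}{\eta_\alpha-\eta_\beta}\Big[i(\boldsymbol S_\alpha\times\boldsymbol S_\beta)+(S+1)\boldsymbol S_\beta-\frac1{S+1}\boldsymbol S_\alpha(\boldsymbol S_\alpha\cdot\boldsymbol S_\beta)\Big],$$ the Hamiltonian $$\tilde H^S=\frac{2\pi^2}{N^2}\Big[\sum_{\alpha\ne\beta}\Big(\frac1{|\eta_\alpha-\eta_\beta|^2}-\frac14\Big)\boldsymbol S_\alpha\cdot\boldsymbol S_\beta-\sum_{\substack{\alpha,\beta,\gamma\\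 \beta\ne\alpha,\ \gamma\ne\alpha}}\Big(\frac1{(\bar\eta_\alpha-\bar\eta_\beta)(\eta_\alpha-\eta_\gamma)}-\frac14\Big)\frac{(\boldsymbol S_\alpha\cdot\boldsymbol S_\beta)(\boldsymbol S_\alpha\cdot\boldsymbol S_\gamma)+(\boldsymbol S_\alpha\cdot\boldsymbol S_\gamma)(\boldsymbol S_\alpha\cdot\boldsymbol S_\beta)}{2(S+1)(2S+3)}\Big]$$ (where $\beta=\gamma$ is allowed in the triple sum), and the number $$\tilde E_0^S=-\frac{\pi^2}{6}\,\frac{S(S+1)^2}{2S+3}\Big(N-\frac4N\Big).$$ Then, with $\boldsymbol D_\alpha^\dagger\boldsymbol D_\alpha=\sum_{i\in\{x,y,z\}}(D^i_\alpha)^\dagger D^i_\alpha$, $$\frac{2\pi^2}{N^2}\Big[\frac1{(2S+1)(2S+3)}\sum_\alpha\boldsymbol D_\alpha^\dagger\boldsymbol D_\alpha+\frac{(S+1)(N-2)}{4(2S+3)}\boldsymbol S_{\rm tot}^2\Big]=\tilde H^S-\tilde E_0^S .$$ Moreover, let $N$ be even and $M=N/2$, let $a_\alpha^\dagger,b_\alpha^\dagger$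 be commuting (Schwinger) boson creation operators with vacuum $|0\rangle$, identify the spin states of a site by $|S,m\rangle=\frac{(a^\dagger)^{S+m}(b^\dagger)^{S-m}}{\sqrt{(S+m)!\,(S-m)!}}|0\rangle$, and put $$|\psi^S_0\rangle=\big(\Psi^{\rm HS}_0[a^\dagger,b^\dagger]\big)^{2S}|0\rangle,\qquad \Psi^{\rm HS}_0[a^\dagger,b^\dagger]=\sum_{\{z_1,\dots,z_M\}}\ \prod_{i<j}(z_i-z_j)^2\prod_{i=1}^M z_i\ \ a^\dagger_{z_1}\cdots a^\dagger_{z_M}\,b^\dagger_{w_1}\cdots b^\dagger_{w_M},$$ where the sum runs over all $M$-element sets of sites and $w_1,\dots,w_M$ are the remaining sites. Then $\tilde H^S$ is Hermitian and $|\psi^S_0\rangle$ is a ground state of $\tilde H^S$ with energy $\tilde E^S_0$: it is nonzero, $\tilde H^S|\psi^S_0\rangle=\tilde E_0^S|\psi^S_0\rangle$, and $\tilde E_0^S$ is the smallest eigenvalue of $\tilde H^S$. -/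

import Mathlib

open scoped Matrix

noncomputable section

namespace SpinChain

/-! ### Single-site spin operators for spin `S = n / 2`

The basis vector with index `k : Fin (n + 1)` is the state `|S, m⟩` with `m = k - S`. -/

/-- The spin quantum number `S = n / 2`. -/
def spin (n : ℕ) : ℝ := (n : ℝ) / 2

/-- `S^z |S, m⟩ = m |S, m⟩`. -/
def szMat (n : ℕ) : Matrix (Fin (n + 1)) (Fin (n + 1)) ℂ :=
  Matrix.diagonal fun k => (((k : ℕ) : ℝ) - spin n : ℝ)

/-- `S^+ |S, m⟩ = √(S(S+1) - m(m+1)) |S, m+1⟩`; for `m = l - S` the number under the root is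
`(n - l) (l + 1)`. -/
def splusMat (n : ℕ) : Matrix (Fin (n + 1)) (Fin (n + 1)) ℂ :=
  Matrix.of fun k l =>
    if (k : ℕ) = (l : ℕ) + 1 then
      ((Real.sqrt (((n : ℝ) - ((l : ℕ) : ℝ)) * (((l : ℕ) : ℝ) + 1)) : ℝ) : ℂ)
    else 0

/-- `S^- = (S^+)†`. -/
def sminusMat (n : ℕ) : Matrix (Fin (n + 1)) (Fin (n + 1)) ℂ := (splusMat n)ᴴ

/-- The spin vector `(S^x, S^y, S^z)`, where `S^± = S^x ± i S^y`. -/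
def spinMat (n : ℕ) : Fin 3 → Matrix (Fin (n + 1)) (Fin (n + 1)) ℂ :=
  ![(1 / 2 : ℂ) • (splusMat n + sminusMat n),
    (1 / (2 * Complex.I)) • (splusMat n - sminusMat n),
    szMat n]

/-! ### The chain with `N` sites -/

/-- Labels of the product basis of the `N`-fold tensor product of the spin-`n / 2` space. -/
abbrev Config (N n : ℕ) : Type := Fin N → Fin (n + 1)

/-- State vectors, in coordinates with respect to the orthonormal product basis. -/
abbrev State (N n : ℕ) : Type := Config N n → ℂ

/-- Linear operators on the Hilbert space of the chain. -/
abbrev Op (N n : ℕ) : Type := Matrix (Config N n) (Config N n) ℂ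

/-- Vector operators (three Cartesian components). -/
abbrev VecOp (N n : ℕ) : Type := Fin 3 → Op N n

/-- `1 ⊗ ⋯ ⊗ A ⊗ ⋯ ⊗ 1` with `A` acting on the site `α`. -/
def siteOp {N n : ℕ} (α : Fin N) (A : Matrix (Fin (n + 1)) (Fin (n + 1)) ℂ) : Op N n :=
  Matrix.of fun σ τ => if ∀ β, β ≠ α → σ β = τ β then A (σ α) (τ α) else 0

/-- The spin vector operator `𝐒_α` of site `α`. -/
def siteSpin (N n : ℕ) (α : Fin N) : VecOp N n := fun i => siteOp α (spinMat n i)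

/-- The total spin `𝐒_tot = ∑_α 𝐒_α`. -/
def totalSpin (N n : ℕ) : VecOp N n := ∑ α, siteSpin N n α

/-- The scalar product `𝐒_α · 𝐒_β`. -/
def spinDot (N n : ℕ) (α β : Fin N) : Op N n := siteSpin N n α ⬝ᵥ siteSpin N n β

/-- The cross product of vector operators, with the order of the factors kept;
indices are taken modulo 3. -/
def crossOp {N n : ℕ} (A B : VecOp N n) : VecOp N n := fun i =>
  A (i + 1) * B (i + 2) - A (i + 2) * B (i + 1)

/-- The site coordinates `η_α = exp(2πiα/N)`, `α = 1, …, N`, on the unit circle;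
the element `α : Fin N` stands for the site number `α + 1`. -/
def site (N : ℕ) (α : Fin N) : ℂ :=
  Complex.exp (2 * Real.pi * Complex.I * (((α : ℕ) + 1 : ℕ) : ℂ) / (N : ℂ))

/-! ### The operators `𝐃_α`, the Hamiltonian and the energy -/

/-- `𝐃_α = ½ ∑_{β ≠ α} (η_α + η_β)/(η_α - η_β)
  [ i (𝐒_α × 𝐒_β) + (S+1) 𝐒_β - (1/(S+1)) 𝐒_α (𝐒_α · 𝐒_β) ]`. -/
def dOp (N n : ℕ) (α : Fin N) : VecOp N n := fun i =>
  (1 / 2 : ℂ) • ∑ β ∈ Finset.univ.erase α,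
    ((site N α + site N β) / (site N α - site N β)) •
      (Complex.I • crossOp (siteSpin N n α) (siteSpin N n β) i
        + ((spin n + 1 : ℝ) : ℂ) • siteSpin N n β i
        - ((1 / (spin n + 1) : ℝ) : ℂ) • (siteSpin N n α i * spinDot N n α β))

/-- `𝐃_α† · 𝐃_α`, the sum over the three components of (adjoint times component). -/
def dDaggerD (N n : ℕ) (α : Fin N) : Op N n := ∑ i, (dOp N n α i)ᴴ * dOp N n α i

/-- The modified Hamiltonian. The sites `β` and `γ` in the triple sum both differ from `α`, but
may coincide. -/
def hTilde (N n : ℕ) : Op N n :=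
  ((2 * Real.pi ^ 2 / (N : ℝ) ^ 2 : ℝ) : ℂ) •
    (∑ α, ∑ β ∈ Finset.univ.erase α,
        ((1 / ‖site N α - site N β‖ ^ 2 - 1 / 4 : ℝ) : ℂ) • spinDot N n α β
      - ∑ α, ∑ β ∈ Finset.univ.erase α, ∑ γ ∈ Finset.univ.erase α,
          (1 / ((star (site N α) - star (site N β)) * (site N α - site N γ)) - 1 / 4) •
            ((1 / (2 * (spin n + 1) * (2 * spin n + 3)) : ℝ) : ℂ) •
              (spinDot N n α β * spinDot N n α γ + spinDot N n α γ * spinDot N n α β))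

/-- The energy `-(π²/6) · S (S+1)² / (2S+3) · (N - 4/N)`. -/
def eTilde (N n : ℕ) : ℝ :=
  -(Real.pi ^ 2 / 6) * (spin n * (spin n + 1) ^ 2 / (2 * spin n + 3)) * ((N : ℝ) - 4 / (N : ℝ))

/-! ### The spin liquid state

The Fock space generated from the vacuum `|0⟩ = 1` by the Schwinger boson creation operators
`a_α†`, `b_α†` is the polynomial ring in the variables `X (Sum.inl α)` (for `a_α†`) and
`X (Sum.inr α)` (for `b_α†`), the creation operators being multiplications by the variables. -/

/-- Polynomials in the creation operators `a_α†`, `b_α†`. -/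
abbrev Fock (N : ℕ) : Type := MvPolynomial (Fin N ⊕ Fin N) ℂ

/-- The Haldane–Shastry amplitude `∏_{i<j} (z_i - z_j)² ∏_i z_i` of the configuration in which the
up spins occupy the set `Z` of sites. -/
def hsAmplitude (N : ℕ) (Z : Finset (Fin N)) : ℂ :=
  (∏ p ∈ (Z ×ˢ Z).filter (fun p => p.1 < p.2), (site N p.1 - site N p.2) ^ 2) *
    ∏ α ∈ Z, site N α

/-- The polynomial `Ψ^HS[a†, b†]`: the sum over all sets of `M = N / 2` sites occupied by up
spins (`a†`), the remaining sites being occupied by down spins (`b†`). -/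
def hsPoly (N : ℕ) : Fock N :=
  ∑ Z ∈ (Finset.univ : Finset (Fin N)).powersetCard (N / 2),
    MvPolynomial.C (hsAmplitude N Z) *
      ((∏ α ∈ Z, MvPolynomial.X (Sum.inl α)) * ∏ α ∈ Zᶜ, MvPolynomial.X (Sum.inr α))

/-- The occupation numbers of the product state `σ`: on site `α` there are `S + m = σ α` bosons
of type `a` and `S - m = n - σ α` bosons of type `b`. -/
def occupation {N n : ℕ} (σ : Config N n) : (Fin N ⊕ Fin N) →₀ ℕ :=
  Finsupp.equivFunOnFinite.symm
    (Sum.elim (fun α => (σ α : ℕ)) (fun α => n - (σ α : ℕ)))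

/-- The coordinates, in the product basis, of a Fock state with `n` bosons on every site, where
`|S, m⟩ = (a†)^(S+m) (b†)^(S-m) |0⟩ / √((S+m)! (S-m)!)`. -/
def fockToState (N n : ℕ) (P : Fock N) : State N n := fun σ =>
  P.coeff (occupation σ) *
    ((∏ α, Real.sqrt (((σ α : ℕ).factorial : ℝ) * ((n - (σ α : ℕ)).factorial : ℝ)) : ℝ) : ℂ)

/-- The spin liquid state `|ψ^S_0⟩ = (Ψ^HS[a†, b†])^{2S} |0⟩`, with `2S = n`. -/
def psi0 (N n : ℕ) : State N n := fockToState N n (hsPoly N ^ n)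

/-- `v` is a ground state, with energy `E`, of the Hermitian operator `H`: a nonzero eigenvector
for the eigenvalue `E`, and `E` is the smallest eigenvalue of `H`. -/
def IsGroundState {N n : ℕ} (H : Op N n) (E : ℝ) (v : State N n) : Prop :=
  H.IsHermitian ∧ v ≠ 0 ∧ H *ᵥ v = (E : ℂ) • v ∧
    ∀ μ : ℝ, Module.End.HasEigenvalue (Matrix.toLin' H) (μ : ℂ) → E ≤ μ

end SpinChain

end

open scoped Matrix

noncomputable section

namespace SpinChain

/-! ### The site coordinates -/

/-! Write θ_{αβ} = (η_α+η_β)/(η_α−η_β), with θ_{αα} = 0; it is purely imaginary and antisymmetric.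
Put F_α = ∑_β θ_{αβ} S_β. Then 2D_α = i(S_α×F_α) + (S+1)F_α − S_α(S_α·F_α)/(S+1), and this bracket
is 2S+1 times the projection of F_α, coupled as a vector to the spin S_α, onto total spin S+1.

Operator identity. Since the projection is idempotent, D_α†D_α collapses to −(2S+1)/4 times
(S+1)F_α² + ∑_β θ_{αβ}² S_α·S_β − (S_α·F_α)²/(S+1); see `sum_projected_mul_projected` and
`dDaggerD_eq`. The lattice sum ∑_α θ_{αβ}θ_{αγ} = N−2+2θ_{βγ}² for β ≠ γ turns ∑_α F_α² into S_tot²,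
∑θ² S·S and a constant. In the Hamiltonian the two coefficient functions are −θ²/4 and, up to a part
antisymmetric in β, γ, −θ_{αβ}θ_{αγ}/4 (`hTilde_eq`). Comparing coefficients gives
`operator_identity`.

Ground state. For N ≥ 2 the identity exhibits H − E as a sum of positive semidefinite operators, so
it suffices that every D_α and the total spin annihilate the state. Spin operators act on boson
polynomials as derivations. For the Haldane–Shastry polynomial Ψ two sums over the sites vanish
because they are sums of polynomials of degree N−1 without constant term: one says that the total S⁻
kills Ψ, the other that F_α⁻ kills the component of Ψ with spin up at α. The first, with S^z Ψ = 0,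
makes Ψ a singlet. Rotating the second then gives the vanishing of the whole spin-3/2 multiplet,
encoded by WΨ = 0 with W = a²F_α⁻ − b²F_α⁺ − 2abF_α^z, where a, b are the bosons of site α
(`spin_multiplet_eq_zero`). Because W is a first-order operator, WΨ = 0 implies WΨ^{2S} = 0 for
every S. Finally WΨ^{2S} has degree 2S+2 in a, b, that is, spin S+1, and its second derivatives
recover the components of D_α applied to the state (`projection_eq_zero`). -/

theorem site_ne_zero (N : ℕ) (α : Fin N) : site N α ≠ 0 := Complex.exp_ne_zero _

theorem site_eq_pow {N : ℕ} (α : Fin N) :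
    site N α = Complex.exp (2 * Real.pi * Complex.I / N) ^ ((α : ℕ) + 1) := by
  rw [site, ← Complex.exp_nat_mul]
  congr 1
  push_cast
  ring

theorem site_injective (N : ℕ) : Function.Injective (site N) := by
  intro α β h
  have hN : N ≠ 0 := fun h0 => by subst h0; exact α.elim0
  have hp := Complex.isPrimitiveRoot_exp N hN
  rw [site_eq_pow, site_eq_pow, pow_succ, pow_succ] at h
  have h' := mul_right_cancel₀ (Complex.exp_ne_zero _) h
  exact Fin.ext (hp.pow_inj α.2 β.2 h')

theorem site_sub_ne_zero {N : ℕ} {α β : Fin N} (h : α ≠ β) : site N α - site N β ≠ 0 :=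
  sub_ne_zero.2 fun h' => h (site_injective N h')

theorem star_site {N : ℕ} (α : Fin N) : star (site N α) = (site N α)⁻¹ := by
  rw [site, ← Complex.exp_neg, Complex.star_def, ← Complex.exp_conj]
  congr 1
  have h2 : (starRingEnd ℂ) 2 = 2 := map_ofNat _ 2
  simp only [map_div₀, map_mul, h2, Complex.conj_ofReal, Complex.conj_I, map_natCast]
  ring

theorem sum_site_pow {N k : ℕ} (hk : 0 < k) (hkN : k < N) : ∑ α, site N α ^ k = 0 := by
  have hp := Complex.isPrimitiveRoot_exp N (by omega)
  set ζ := Complex.exp (2 * Real.pi * Complex.I / N) with hζ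
  have h1 : ζ ^ k ≠ 1 := hp.pow_ne_one_of_pos_of_lt hk.ne' hkN
  have h2 : ∑ i ∈ Finset.range N, (ζ ^ k) ^ i = 0 := by
    rw [geom_sum_eq h1, ← pow_mul, mul_comm k N, pow_mul, hp.pow_eq_one]
    simp
  calc ∑ α, site N α ^ k = ∑ α : Fin N, ζ ^ k * (ζ ^ k) ^ (α : ℕ) := by
        refine Finset.sum_congr rfl fun α _ => ?_
        rw [site_eq_pow, ← hζ]; ring
    _ = 0 := by
        rw [← Finset.mul_sum, Fin.sum_univ_eq_sum_range (fun i => (ζ ^ k) ^ i), h2, mul_zero]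

/-- A polynomial of degree less than `N` without constant term sums to zero over the sites. -/
theorem sum_eval_site {N : ℕ} (p : Polynomial ℂ) (h0 : p.coeff 0 = 0) (hd : p.natDegree < N) :
    ∑ α, p.eval (site N α) = 0 := by
  simp_rw [Polynomial.eval_eq_sum_range' hd]
  rw [Finset.sum_comm]
  refine Finset.sum_eq_zero fun k hk => ?_
  rw [← Finset.mul_sum]
  rcases Nat.eq_zero_or_pos k with rfl | hpos
  · simp [h0]
  · rw [sum_site_pow hpos (Finset.mem_range.1 hk), mul_zero]

/-! ### The coefficients of the operators `𝐃_α` -/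

/-- The coefficient `(η_α + η_β) / (η_α - η_β)`, which is `0` for `α = β`. -/
def theta (N : ℕ) (α β : Fin N) : ℂ := (site N α + site N β) / (site N α - site N β)

@[simp] theorem theta_self {N : ℕ} (α : Fin N) : theta N α α = 0 := by simp [theta]

theorem theta_swap {N : ℕ} (α β : Fin N) : theta N β α = -theta N α β := by
  rw [theta, theta, ← div_neg, neg_sub, add_comm]

theorem star_theta {N : ℕ} (α β : Fin N) : star (theta N α β) = -theta N α β := by
  rcases eq_or_ne α β with rfl | h
  · simp
  have h1 := site_sub_ne_zero h
  have h2 := site_ne_zero N α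
  have h3 := site_ne_zero N β
  have h4 : (site N α)⁻¹ - (site N β)⁻¹ ≠ 0 := by
    rw [sub_ne_zero]; exact fun h' => h (site_injective N (inv_injective h'))
  rw [theta, star_div₀, star_add, star_sub, star_site, star_site, ← neg_div,
    div_eq_div_iff h4 h1]
  field_simp
  ring

/-- The addition theorem of the cotangent, in exponential form. It reduces products of two
coefficients at α to terms linear in α-dependent coefficients, which sum to zero. -/
theorem theta_mul_theta {N : ℕ} {α β γ : Fin N} (h1 : α ≠ β) (h2 : α ≠ γ) (h3 : β ≠ γ) :
    theta N α β * theta N α γ = 1 + theta N β γ * (theta N α β + theta N γ α) := by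
  have h1' := site_sub_ne_zero h1
  have h2' := site_sub_ne_zero h2
  have h3' := site_sub_ne_zero h3
  have h4' := site_sub_ne_zero h2.symm
  rw [theta_swap α γ]
  simp only [theta]
  field_simp
  ring

/-- The reflection β ↦ 2α − β of the cyclic lattice sends η_β to η_α²/η_β and hence changes the sign
of θ_{αβ}. -/
theorem sum_theta {N : ℕ} (α : Fin N) : ∑ β, theta N α β = 0 := by
  have : NeZero N := ⟨fun h0 => by subst h0; exact α.elim0⟩
  -- The extra factor compensates the shift by one between the index in `Fin N` and the exponent of
  -- the root of unity.
  have hs : ∀ β γ : Fin N, site N (β + γ) * Complex.exp (2 * Real.pi * Complex.I / N) =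
      site N β * site N γ := by
    intro β γ
    have hp := Complex.isPrimitiveRoot_exp N (NeZero.ne N)
    rw [site_eq_pow, site_eq_pow, site_eq_pow, pow_succ _ ((β + γ : Fin N) : ℕ), Fin.val_add,
      ← pow_eq_pow_mod _ hp.pow_eq_one]
    ring
  have key : ∀ β, theta N α (α + α - β) = - theta N α β := by
    intro β
    have h1 : site N (α + α - β) * site N β = site N α * site N α := by
      rw [← hs, ← hs]; simp
    have h2 : site N (α + α - β) = site N α * site N α / site N β := by
      rw [eq_div_iff (site_ne_zero N β), h1]
    have h3 := site_ne_zero N β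
    have h4 := site_ne_zero N α
    rcases eq_or_ne α β with rfl | h
    · simp
    have h5 := site_sub_ne_zero h
    have h5' := site_sub_ne_zero h.symm
    rw [theta, theta, h2]
    have : site N α - site N α * site N α / site N β =
      site N α * (site N β - site N α) / site N β := by field_simp
    rw [this]
    field_simp
    ring
  have : ∑ β, theta N α β = - ∑ β, theta N α β := by
    rw [← Finset.sum_neg_distrib]
    refine (Fintype.sum_equiv (Equiv.subLeft (α + α)) _ _ fun β => ?_)
    simp [key]
  exact self_eq_neg.1 this

theorem sum_theta_left {N : ℕ} (β : Fin N) : ∑ α, theta N α β = 0 := by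
  simp_rw [fun α => theta_swap β α, Finset.sum_neg_distrib, sum_theta, neg_zero]

theorem sum_theta_mul_theta {N : ℕ} {β γ : Fin N} (h : β ≠ γ) :
    ∑ α, theta N α β * theta N α γ = (N : ℂ) - 2 + 2 * theta N β γ ^ 2 := by
  -- The addition theorem fails at α = β and α = γ, where the left side is 0; the two `if` terms
  -- subtract these exceptions.
  have key : ∀ α, theta N α β * theta N α γ = 1 + theta N β γ * (theta N α β + theta N γ α)
      - (if α = β then 1 + theta N β γ * theta N γ β else 0)
      - (if α = γ then 1 + theta N β γ * theta N γ β else 0) := by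
    intro α
    rcases eq_or_ne α β with rfl | h1
    · simp [h]
    rcases eq_or_ne α γ with rfl | h2
    · simp [h1]
    simp [h1, h2, theta_mul_theta h1 h2 h]
  simp_rw [key]
  simp only [Finset.sum_sub_distrib, Finset.sum_add_distrib, ← Finset.mul_sum, sum_theta,
    sum_theta_left, Finset.sum_ite_eq', Finset.mem_univ, if_true, theta_swap β γ]
  simp
  ring

/-- Isolating the coincident case as a correction term gives one formula that can be summed over all
pairs of sites. -/
theorem sum_theta_mul_theta_ite {N : ℕ} (β γ : Fin N) :
    ∑ α, theta N α β * theta N α γ = (N : ℂ) - 2 + 2 * theta N β γ ^ 2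
      + if β = γ then ∑ α, theta N β α ^ 2 - ((N : ℂ) - 2) else 0 := by
  rcases eq_or_ne β γ with rfl | h
  · have h : ∀ α, theta N α β * theta N α β = theta N β α ^ 2 := fun α => by
      rw [theta_swap β α]
      ring
    simp only [theta_self, if_true, h]
    ring
  · rw [sum_theta_mul_theta h, if_neg h, add_zero]

/-- Summing the product formula over all β, γ gives ∑_α (∑_β θ_{αβ})² = 0 on one side and an affine
function 3T + const of the unknown T on the other, so T is found without evaluating any
trigonometric sum. -/
theorem sum_sum_theta_sq (N : ℕ) :
    ∑ α, ∑ β, theta N α β ^ 2 = -((N : ℂ) * (N - 1) * (N - 2) / 3) := by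
  set T := ∑ α, ∑ β, theta N α β ^ 2 with hT
  have h0 : ∑ β, ∑ γ, ∑ α, theta N α β * theta N α γ = 0 := by
    rw [Finset.sum_congr rfl fun β _ => Finset.sum_comm, Finset.sum_comm]
    refine Finset.sum_eq_zero fun α _ => ?_
    rw [← Finset.sum_mul_sum, sum_theta, zero_mul]
  simp_rw [sum_theta_mul_theta_ite, Finset.sum_add_distrib, Finset.sum_ite_eq, Finset.mem_univ, if_true,
    Finset.sum_sub_distrib, ← Finset.mul_sum] at h0
  rw [← hT] at h0
  simp only [Finset.sum_const, Finset.card_univ, Fintype.card_fin, nsmul_eq_mul] at h0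
  linear_combination h0 / 3

theorem inv_mul_sub_quarter {N : ℕ} {α β γ : Fin N} (h1 : α ≠ β) (h2 : α ≠ γ) :
    1 / ((star (site N α) - star (site N β)) * (site N α - site N γ)) - 1 / 4 =
      1 / 4 * (theta N α γ - theta N α β - theta N α β * theta N α γ) := by
  have h1' := site_sub_ne_zero h1
  have h1'' := site_sub_ne_zero h1.symm
  have h2' := site_sub_ne_zero h2
  have h3 := site_ne_zero N α
  have h4 := site_ne_zero N β
  have : (site N α)⁻¹ - (site N β)⁻¹ = -(site N α - site N β) / (site N α * site N β) := by
    field_simp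
    ring
  rw [star_site, star_site, this]
  simp only [theta]
  field_simp
  ring

theorem inv_norm_sq_sub_quarter {N : ℕ} {α β : Fin N} (h : α ≠ β) :
    ((1 / ‖site N α - site N β‖ ^ 2 - 1 / 4 : ℝ) : ℂ) = -(1 / 4) * theta N α β ^ 2 := by
  have h1 := inv_mul_sub_quarter h h
  rw [← star_sub] at h1
  have h2 : star (site N α - site N β) * (site N α - site N β) =
      (‖site N α - site N β‖ : ℂ) ^ 2 := by
    rw [Complex.star_def, Complex.conj_mul']
  rw [h2] at h1
  push_cast
  rw [h1]
  ring

/-! ### The spin matrices of one site -/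

theorem splusMat_mul_sminusMat (n : ℕ) : splusMat n * sminusMat n =
    Matrix.diagonal fun k : Fin (n + 1) => ((n : ℂ) + 1 - (k : ℕ)) * (k : ℕ) := by
  ext k l
  simp only [Matrix.mul_apply, sminusMat, Matrix.conjTranspose_apply, splusMat, Matrix.of_apply,
    Matrix.diagonal_apply]
  rcases Nat.eq_zero_or_pos (k : ℕ) with hk | hk
  · rw [Finset.sum_eq_zero]
    · simp [hk]
    · intro j _
      rw [if_neg (by omega), zero_mul]
  · have hk' : (k : ℕ) - 1 < n + 1 := by omega
    rw [Finset.sum_eq_single (⟨(k : ℕ) - 1, hk'⟩ : Fin (n + 1))]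
    · simp only
      rw [if_pos (by omega)]
      by_cases h : k = l
      · subst h
        rw [if_pos (by omega), if_pos rfl, Complex.star_def, Complex.conj_ofReal,
          ← Complex.ofReal_mul, Real.mul_self_sqrt]
        · push_cast [Nat.cast_sub (show 1 ≤ (k : ℕ) from hk)]
          ring
        · have h1 : (((k : ℕ) - 1 : ℕ) : ℝ) ≤ n := by exact_mod_cast (by omega : (k : ℕ) - 1 ≤ n)
          have h2 : (0 : ℝ) ≤ (((k : ℕ) - 1 : ℕ) : ℝ) := Nat.cast_nonneg _
          nlinarith
      · rw [if_neg (fun h' => h (Fin.ext (by omega))), if_neg h]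
        simp
    · intro j _ hj
      rw [if_neg (fun h' => hj (Fin.ext (by simp only; omega))), zero_mul]
    · simp

theorem sminusMat_mul_splusMat (n : ℕ) : sminusMat n * splusMat n =
    Matrix.diagonal fun k : Fin (n + 1) => ((n : ℂ) - (k : ℕ)) * ((k : ℕ) + 1) := by
  ext k l
  simp only [Matrix.mul_apply, sminusMat, Matrix.conjTranspose_apply, splusMat, Matrix.of_apply,
    Matrix.diagonal_apply]
  by_cases hk : (k : ℕ) = n
  · rw [Finset.sum_eq_zero]
    · simp [hk]
    · intro j _
      rw [if_neg (by omega), star_zero, zero_mul]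
  · have hk' : (k : ℕ) + 1 < n + 1 := by omega
    rw [Finset.sum_eq_single (⟨(k : ℕ) + 1, hk'⟩ : Fin (n + 1))]
    · simp only
      rw [if_pos trivial]
      by_cases h : k = l
      · subst h
        rw [if_pos rfl, if_pos rfl, Complex.star_def, Complex.conj_ofReal,
          ← Complex.ofReal_mul, Real.mul_self_sqrt]
        · push_cast
          ring
        · have h1 : ((k : ℕ) : ℝ) ≤ n := by exact_mod_cast (by omega : (k : ℕ) ≤ n)
          have h2 : (0 : ℝ) ≤ ((k : ℕ) : ℝ) := Nat.cast_nonneg _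
          nlinarith
      · rw [if_neg (fun h' => h (Fin.ext (by omega))), if_neg h]
        simp
    · intro j _ hj
      rw [if_neg (fun h' => hj (Fin.ext (by simp only; omega))), star_zero, zero_mul]
    · simp

theorem conjTranspose_szMat (n : ℕ) : (szMat n)ᴴ = szMat n := by
  rw [szMat, Matrix.diagonal_conjTranspose]
  congr 1
  ext k
  simp

theorem splusMat_mul_sminusMat_sub (n : ℕ) :
    splusMat n * sminusMat n - sminusMat n * splusMat n = (2 : ℂ) • szMat n := by
  rw [splusMat_mul_sminusMat, sminusMat_mul_splusMat, szMat, Matrix.diagonal_sub,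
    ← Matrix.diagonal_smul]
  congr 1
  ext k
  simp [spin]
  ring

theorem szMat_mul_splusMat_sub (n : ℕ) :
    szMat n * splusMat n - splusMat n * szMat n = splusMat n := by
  ext k l
  rw [Matrix.sub_apply, szMat, Matrix.diagonal_mul, Matrix.mul_diagonal, splusMat, Matrix.of_apply]
  split_ifs with h
  · rw [h]
    push_cast
    ring
  · simp

theorem szMat_mul_sminusMat_sub (n : ℕ) :
    szMat n * sminusMat n - sminusMat n * szMat n = -sminusMat n := by
  have h := congrArg Matrix.conjTranspose (szMat_mul_splusMat_sub n)
  rw [Matrix.conjTranspose_sub, Matrix.conjTranspose_mul, Matrix.conjTranspose_mul,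
    conjTranspose_szMat] at h
  rw [← neg_sub]
  exact congrArg _ h

theorem spinMat_casimir_ladder (n : ℕ) :
    (1 / 2 : ℂ) • (splusMat n * sminusMat n + sminusMat n * splusMat n) + szMat n * szMat n =
      ((spin n * (spin n + 1) : ℝ) : ℂ) • (1 : Matrix (Fin (n + 1)) (Fin (n + 1)) ℂ) := by
  rw [splusMat_mul_sminusMat, sminusMat_mul_splusMat, szMat, Matrix.diagonal_mul_diagonal,
    Matrix.diagonal_add, ← Matrix.diagonal_smul, Matrix.diagonal_add, ← Matrix.diagonal_one,
    ← Matrix.diagonal_smul]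
  congr 1
  ext k
  simp [spin]
  ring

theorem conjTranspose_spinMat (n : ℕ) (i : Fin 3) : (spinMat n i)ᴴ = spinMat n i := by
  fin_cases i
  · simp [spinMat, sminusMat, add_comm]
  · simp only [spinMat, sminusMat, Fin.mk_one, Matrix.cons_val_one, Matrix.cons_val_zero,
      Matrix.conjTranspose_smul, Matrix.conjTranspose_sub, Matrix.conjTranspose_conjTranspose]
    rw [← neg_sub (splusMat n), smul_neg, ← neg_smul]
    congr 1
    simp
  · exact conjTranspose_szMat n

theorem spinMat_zero (n : ℕ) : spinMat n 0 = (1 / 2 : ℂ) • (splusMat n + sminusMat n) := rfl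

theorem spinMat_one (n : ℕ) :
    spinMat n 1 = (-(Complex.I / 2)) • (splusMat n - sminusMat n) := by
  have : spinMat n 1 = (1 / (2 * Complex.I)) • (splusMat n - sminusMat n) := rfl
  rw [this]
  congr 1
  field_simp
  simp

theorem spinMat_two (n : ℕ) : spinMat n 2 = szMat n := rfl

theorem spinMat_commutator (n : ℕ) (i : Fin 3) :
    spinMat n i * spinMat n (i + 1) - spinMat n (i + 1) * spinMat n i =
      Complex.I • spinMat n (i + 2) := by
  have h1 := splusMat_mul_sminusMat_sub n
  have h2 := szMat_mul_splusMat_sub n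
  have h3 := szMat_mul_sminusMat_sub n
  have hI : Complex.I * -(Complex.I / 2) = 1 / 2 := by
    linear_combination (-1 / 2 : ℂ) * Complex.I_mul_I
  fin_cases i
  · change spinMat n 0 * spinMat n 1 - spinMat n 1 * spinMat n 0 = Complex.I • spinMat n 2
    simp only [spinMat_zero, spinMat_one, spinMat_two, smul_mul_assoc, mul_smul_comm,
      mul_add, mul_sub, add_mul, sub_mul]
    linear_combination (norm := module) (1 / 2 * Complex.I) • h1
  · change spinMat n 1 * spinMat n 2 - spinMat n 2 * spinMat n 1 = Complex.I • spinMat n 0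
    simp only [spinMat_zero, spinMat_one, spinMat_two, smul_mul_assoc, mul_smul_comm,
      mul_sub, sub_mul]
    linear_combination (norm := module) (1 / 2 * Complex.I) • h2 - (1 / 2 * Complex.I) • h3
  · change spinMat n 2 * spinMat n 0 - spinMat n 0 * spinMat n 2 = Complex.I • spinMat n 1
    simp only [spinMat_zero, spinMat_one, spinMat_two, smul_mul_assoc, mul_smul_comm,
      mul_add, add_mul, smul_smul, hI]
    linear_combination (norm := module) (1 / 2 : ℂ) • h2 + (1 / 2 : ℂ) • h3

theorem sum_spinMat_mul_self (n : ℕ) : ∑ i, spinMat n i * spinMat n i =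
    ((spin n * (spin n + 1) : ℝ) : ℂ) • (1 : Matrix (Fin (n + 1)) (Fin (n + 1)) ℂ) := by
  have hI : -(Complex.I / 2) * -(Complex.I / 2) = -(1 / 4) := by
    linear_combination (1 / 4 : ℂ) * Complex.I_mul_I
  rw [Fin.sum_univ_three, ← spinMat_casimir_ladder]
  rw [spinMat_zero, spinMat_one, spinMat_two, smul_mul_smul_comm, smul_mul_smul_comm, hI]
  simp only [mul_add, add_mul, mul_sub, sub_mul]
  module

/-! ### Operators acting on one site -/

/-- Only configurations that agree with σ off the site contribute, and these are parametrized by the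
value at the site. Products of site operators are later compared through this action. -/
theorem siteOp_mulVec {N n : ℕ} (α : Fin N) (A : Matrix (Fin (n + 1)) (Fin (n + 1)) ℂ)
    (v : State N n) (σ : Config N n) :
    (siteOp α A *ᵥ v) σ = ∑ k, A (σ α) k * v (Function.update σ α k) := by
  symm
  refine Fintype.sum_of_injective (Function.update σ α) (Function.update_injective σ α) _ _ ?_ ?_
  · intro τ hτ
    simp only [siteOp, Matrix.of_apply]
    rw [if_neg, zero_mul]
    intro h
    refine hτ ⟨τ α, ?_⟩
    ext1 β
    rcases eq_or_ne β α with rfl | hβ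
    · simp
    · rw [Function.update_of_ne hβ, h β hβ]
  · intro k
    simp only [siteOp, Matrix.of_apply, Function.update_self]
    rw [if_pos]
    intro β hβ
    rw [Function.update_of_ne hβ]

/-- The embedding of the operators of the site `α` into the operators of the chain. -/
def siteAlgHom (N n : ℕ) (α : Fin N) :
    Matrix (Fin (n + 1)) (Fin (n + 1)) ℂ →ₐ[ℂ] Op N n :=
  AlgHom.ofLinearMap
    { toFun := siteOp α
      map_add' := fun A B => by
        ext σ τ
        simp only [siteOp, Matrix.of_apply, Matrix.add_apply]
        split_ifs <;> simp
      map_smul' := fun c A => by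
        ext σ τ
        simp only [siteOp, Matrix.of_apply, Matrix.smul_apply, RingHom.id_apply]
        split_ifs <;> simp }
    (by
      ext σ τ
      simp only [LinearMap.coe_mk, AddHom.coe_mk, siteOp, Matrix.of_apply, Matrix.one_apply]
      by_cases h : σ = τ
      · simp [h]
      · rw [if_neg h]
        split_ifs with h1 h2
        · refine absurd (funext fun β => ?_) h
          rcases eq_or_ne β α with rfl | hβ
          exacts [h2, h1 β hβ]
        · rfl
        · rfl)
    (fun A B => by
      refine Matrix.mulVec_injective (funext fun v => funext fun σ => ?_)
      simp only [LinearMap.coe_mk, AddHom.coe_mk]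
      rw [← Matrix.mulVec_mulVec]
      simp only [siteOp_mulVec, Function.update_self, Function.update_idem, Matrix.mul_apply,
        Finset.mul_sum, Finset.sum_mul]
      rw [Finset.sum_comm]
      simp only [mul_assoc])

theorem siteAlgHom_apply {N n : ℕ} (α : Fin N) (A : Matrix (Fin (n + 1)) (Fin (n + 1)) ℂ) :
    siteAlgHom N n α A = siteOp α A := rfl

theorem siteOp_conjTranspose {N n : ℕ} (α : Fin N)
    (A : Matrix (Fin (n + 1)) (Fin (n + 1)) ℂ) : (siteOp (N := N) α A)ᴴ = siteOp α Aᴴ := by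
  ext σ τ
  simp only [siteOp, Matrix.of_apply, Matrix.conjTranspose_apply]
  simp only [eq_comm (a := τ _)]
  split_ifs <;> simp

theorem siteOp_commute {N n : ℕ} {α β : Fin N} (h : α ≠ β)
    (A B : Matrix (Fin (n + 1)) (Fin (n + 1)) ℂ) :
    siteOp α A * siteOp β B = siteOp β B * siteOp (N := N) α A := by
  refine Matrix.mulVec_injective (funext fun v => funext fun σ => ?_)
  rw [← Matrix.mulVec_mulVec, ← Matrix.mulVec_mulVec]
  simp only [siteOp_mulVec, Finset.mul_sum, Function.update_of_ne h, Function.update_of_ne h.symm]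
  rw [Finset.sum_comm]
  refine Finset.sum_congr rfl fun k _ => Finset.sum_congr rfl fun l _ => ?_
  rw [Function.update_comm h]
  ring

theorem siteSpin_conjTranspose (N n : ℕ) (α : Fin N) (i : Fin 3) :
    (siteSpin N n α i)ᴴ = siteSpin N n α i := by
  rw [siteSpin, siteOp_conjTranspose, conjTranspose_spinMat]

theorem siteSpin_commute {N n : ℕ} {α β : Fin N} (h : α ≠ β) (i j : Fin 3) :
    siteSpin N n α i * siteSpin N n β j = siteSpin N n β j * siteSpin N n α i :=
  siteOp_commute h _ _

theorem siteSpin_commutator {N n : ℕ} (α : Fin N) (i : Fin 3) :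
    siteSpin N n α i * siteSpin N n α (i + 1) - siteSpin N n α (i + 1) * siteSpin N n α i =
      Complex.I • siteSpin N n α (i + 2) := by
  simp only [siteSpin, ← siteAlgHom_apply]
  rw [← map_mul, ← map_mul, ← map_sub, spinMat_commutator, map_smul]

theorem sum_siteSpin_mul_self {N n : ℕ} (α : Fin N) :
    ∑ i, siteSpin N n α i * siteSpin N n α i =
      ((spin n * (spin n + 1) : ℝ) : ℂ) • (1 : Op N n) := by
  simp only [siteSpin, ← siteAlgHom_apply, ← map_mul]
  rw [← map_sum, sum_spinMat_mul_self, map_smul, map_one]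

/-! ### Algebra of two commuting triples of operators -/

section Triples

variable {A : Type*} [Ring A] [Algebra ℂ A]

/-- Lagrange's identity (S×F)² = S²F² − (S·F)² for commuting triples; the noncommutativity inside
each triple contributes the product of the two commutators, which is −S·G. -/
theorem sum_cross_mul_cross {S F G : Fin 3 → A} {c : ℂ}
    (hSF : ∀ i j, F i * S j = S j * F i)
    (hS : ∀ i, S i * S (i + 1) - S (i + 1) * S i = Complex.I • S (i + 2))
    (hF : ∀ i, F i * F (i + 1) - F (i + 1) * F i = Complex.I • G (i + 2))
    (hc : ∑ i, S i * S i = c • (1 : A)) :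
    ∑ i, (S (i + 1) * F (i + 2) - S (i + 2) * F (i + 1)) *
        (S (i + 1) * F (i + 2) - S (i + 2) * F (i + 1)) =
      c • (∑ i, F i * F i) - (∑ i, S i * F i) * (∑ i, S i * F i) - ∑ i, S i * G i := by
  -- Used as a rewrite rule, this brings every word to the form with all S to the left of all F,
  -- after which the identity is additive.
  have hSF' : ∀ i j (x : A), F i * (S j * x) = S j * (F i * x) := fun i j x => by
    rw [← mul_assoc, hSF, mul_assoc]
  have key : ∑ i, (S i * S (i + 1) - S (i + 1) * S i) * (F i * F (i + 1) - F (i + 1) * F i) =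
      -∑ i, S i * G i := by
    simp only [hS, hF, smul_mul_smul_comm, Complex.I_mul_I, neg_one_smul, Finset.sum_neg_distrib]
    exact congrArg _ (Equiv.sum_comp (Equiv.addRight (2 : Fin 3)) fun i => S i * G i)
  have hc' : (∑ i, S i * S i) * (∑ i, F i * F i) = c • (∑ i, F i * F i) := by
    rw [hc, smul_mul_assoc, one_mul]
  rw [← hc', ← sub_eq_zero]
  rw [← sub_eq_zero] at key
  rw [← key]
  simp only [Fin.sum_univ_three, zero_add, Fin.isValue, Fin.reduceAdd,
    mul_add, add_mul, mul_sub, sub_mul,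
    mul_assoc, hSF']
  abel

theorem sum_mul_cross {S F : Fin 3 → A}
    (hS : ∀ i, S i * S (i + 1) - S (i + 1) * S i = Complex.I • S (i + 2)) :
    ∑ i, S i * (S (i + 1) * F (i + 2) - S (i + 2) * F (i + 1)) =
      Complex.I • ∑ i, S i * F i := by
  have key : ∑ i, (S i * S (i + 1) - S (i + 1) * S i) * F (i + 2) =
      Complex.I • ∑ i, S i * F i := by
    simp only [hS, smul_mul_assoc, ← Finset.smul_sum]
    exact congrArg _ (Equiv.sum_comp (Equiv.addRight (2 : Fin 3)) fun i => S i * F i)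
  rw [← key]
  simp only [Fin.sum_univ_three, zero_add, Fin.isValue, Fin.reduceAdd,
    mul_sub, sub_mul, mul_assoc]
  abel

theorem sum_cross_mul {S F : Fin 3 → A} (hSF : ∀ i j, F i * S j = S j * F i)
    (hS : ∀ i, S i * S (i + 1) - S (i + 1) * S i = Complex.I • S (i + 2)) :
    ∑ i, (S (i + 1) * F (i + 2) - S (i + 2) * F (i + 1)) * S i =
      -(Complex.I • ∑ i, S i * F i) := by
  rw [← sum_mul_cross hS]
  simp only [Fin.sum_univ_three, zero_add, Fin.isValue, Fin.reduceAdd,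
    mul_sub, sub_mul, mul_assoc, hSF]
  abel

theorem sum_cross_mul' {S F G : Fin 3 → A}
    (hF : ∀ i, F i * F (i + 1) - F (i + 1) * F i = Complex.I • G (i + 2)) :
    ∑ i, (S (i + 1) * F (i + 2) - S (i + 2) * F (i + 1)) * F i =
      Complex.I • ∑ i, S i * G i := by
  have key : ∑ i, S (i + 2) * (F i * F (i + 1) - F (i + 1) * F i) =
      Complex.I • ∑ i, S i * G i := by
    simp only [hF, mul_smul_comm, ← Finset.smul_sum]
    exact congrArg _ (Equiv.sum_comp (Equiv.addRight (2 : Fin 3)) fun i => S i * G i)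
  rw [← key]
  simp only [Fin.sum_univ_three, zero_add, Fin.isValue, Fin.reduceAdd,
    mul_sub, sub_mul, mul_assoc]
  abel

theorem sum_mul_cross' {S F G : Fin 3 → A} (hSF : ∀ i j, F i * S j = S j * F i)
    (hF : ∀ i, F i * F (i + 1) - F (i + 1) * F i = Complex.I • G (i + 2)) :
    ∑ i, F i * (S (i + 1) * F (i + 2) - S (i + 2) * F (i + 1)) =
      -(Complex.I • ∑ i, S i * G i) := by
  have hSF' : ∀ i j (x : A), F i * (S j * x) = S j * (F i * x) := fun i j x => by
    rw [← mul_assoc, hSF, mul_assoc]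
  rw [← sum_cross_mul' hF]
  simp only [Fin.sum_univ_three, zero_add, Fin.isValue, Fin.reduceAdd,
    mul_sub, sub_mul, mul_assoc, hSF']
  abel

/-- On the part of total spin S+1, S or S−1 of the coupling, i(S×·) takes the value S, −1 or −(S+1),
so the operator applied to F is 2s+1 times the projection onto spin S+1. Its square is therefore
2s+1 times itself, and the right side is that operator sandwiched between F and F. The formal proof
expands the product instead. -/
theorem sum_projected_mul_projected {S F G : Fin 3 → A} {s : ℂ} (hs : s + 1 ≠ 0)
    (hSF : ∀ i j, F i * S j = S j * F i)
    (hS : ∀ i, S i * S (i + 1) - S (i + 1) * S i = Complex.I • S (i + 2))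
    (hF : ∀ i, F i * F (i + 1) - F (i + 1) * F i = Complex.I • G (i + 2))
    (hc : ∑ i, S i * S i = (s * (s + 1)) • (1 : A)) :
    ∑ i, (-(Complex.I • (S (i + 1) * F (i + 2) - S (i + 2) * F (i + 1))) + (s + 1) • F i
          - (1 / (s + 1)) • ((∑ j, S j * F j) * S i)) *
        (Complex.I • (S (i + 1) * F (i + 2) - S (i + 2) * F (i + 1)) + (s + 1) • F i
          - (1 / (s + 1)) • (S i * ∑ j, S j * F j)) =
      (2 * s + 1) • ((s + 1) • (∑ i, F i * F i) + (∑ i, S i * G i)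
        - (1 / (s + 1)) • ((∑ i, S i * F i) * ∑ i, S i * F i)) := by
  have h1 := sum_cross_mul_cross hSF hS hF hc
  have h2 := sum_mul_cross (F := F) hS
  have h3 := sum_cross_mul hSF hS
  have h4 := sum_cross_mul' (S := S) hF
  have h5 := sum_mul_cross' hSF hF
  set C : Fin 3 → A := fun i => S (i + 1) * F (i + 2) - S (i + 2) * F (i + 1) with hC
  set Q := ∑ i, S i * F i with hQ
  have hQ' : ∑ i, F i * S i = Q := Finset.sum_congr rfl fun i _ => hSF i i
  set P := ∑ i, S i * G i with hP
  change ∑ i, C i * C i = _ at h1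
  change ∑ i, S i * C i = _ at h2
  change ∑ i, C i * S i = _ at h3
  change ∑ i, C i * F i = _ at h4
  change ∑ i, F i * C i = _ at h5
  change ∑ i, (-(Complex.I • C i) + (s + 1) • F i - (1 / (s + 1)) • (Q * S i)) *
        (Complex.I • C i + (s + 1) • F i - (1 / (s + 1)) • (S i * Q)) = _
  have e : ∀ i, (-(Complex.I • C i) + (s + 1) • F i - (1 / (s + 1)) • (Q * S i)) *
        (Complex.I • C i + (s + 1) • F i - (1 / (s + 1)) • (S i * Q)) =
      C i * C i - (Complex.I * (s + 1)) • (C i * F i) + (Complex.I * (1 / (s + 1))) • (C i * S i * Q)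
      + (Complex.I * (s + 1)) • (F i * C i) + ((s + 1) * (s + 1)) • (F i * F i)
      - ((s + 1) * (1 / (s + 1))) • (F i * S i * Q) - (Complex.I * (1 / (s + 1))) • (Q * (S i * C i))
      - ((s + 1) * (1 / (s + 1))) • (Q * (S i * F i))
      + ((1 / (s + 1)) * (1 / (s + 1))) • (Q * (S i * S i) * Q) := by
    intro i
    simp only [neg_add_eq_sub, mul_add, sub_mul, add_mul, mul_sub, smul_mul_smul_comm,
      Complex.I_mul_I, mul_assoc, neg_one_smul]
    module
  simp only [e, Finset.sum_sub_distrib, Finset.sum_add_distrib, ← Finset.smul_sum,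
    ← Finset.mul_sum, ← Finset.sum_mul, h1, h2, h3, h4, h5, hc, ← hQ, hQ', neg_mul,
    smul_mul_assoc, mul_smul_comm, mul_one, smul_neg, smul_smul]
  match_scalars
  · field_simp
    ring
  · field_simp
    linear_combination (-2) * Complex.I_mul_I
  · field_simp
    linear_combination (-2 * s - 2) * Complex.I_mul_I

end Triples

/-! ### The operator identity -/

/-- The vector operator `∑_β θ_{αβ} 𝐒_β`. -/
def thetaSpin (N n : ℕ) (α : Fin N) : VecOp N n := fun i =>
  ∑ β, theta N α β • siteSpin N n β i

theorem spinDot_eq_sum (N n : ℕ) (α β : Fin N) :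
    spinDot N n α β = ∑ i, siteSpin N n α i * siteSpin N n β i := rfl

theorem sum_siteSpin_mul_thetaSpin (N n : ℕ) (α : Fin N) :
    ∑ i, siteSpin N n α i * thetaSpin N n α i = ∑ β, theta N α β • spinDot N n α β := by
  simp only [thetaSpin, spinDot_eq_sum, Finset.mul_sum, Finset.smul_sum, mul_smul_comm]
  exact Finset.sum_comm

theorem thetaSpin_mul_siteSpin (N n : ℕ) (α : Fin N) (i j : Fin 3) :
    thetaSpin N n α i * siteSpin N n α j = siteSpin N n α j * thetaSpin N n α i := by
  simp only [thetaSpin, Finset.mul_sum, Finset.sum_mul, mul_smul_comm, smul_mul_assoc]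
  refine Finset.sum_congr rfl fun β _ => ?_
  rcases eq_or_ne α β with rfl | h
  · simp
  · rw [siteSpin_commute h]

theorem thetaSpin_conjTranspose (N n : ℕ) (α : Fin N) (i : Fin 3) :
    (thetaSpin N n α i)ᴴ = -thetaSpin N n α i := by
  simp only [thetaSpin, Matrix.conjTranspose_sum, Matrix.conjTranspose_smul, star_theta,
    siteSpin_conjTranspose, neg_smul, Finset.sum_neg_distrib]

/-- Spins at different sites commute, so only the diagonal terms survive and the weights get
squared. The resulting vector plays the role of G in the algebra of triples. -/
theorem thetaSpin_commutator (N n : ℕ) (α : Fin N) (i : Fin 3) :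
    thetaSpin N n α i * thetaSpin N n α (i + 1) - thetaSpin N n α (i + 1) * thetaSpin N n α i =
      Complex.I • ∑ β, theta N α β ^ 2 • siteSpin N n β (i + 2) := by
  simp only [thetaSpin]
  rw [Finset.sum_mul_sum, Finset.sum_mul_sum, Finset.sum_comm (s := Finset.univ)
    (f := fun β γ => theta N α β • siteSpin N n β (i + 1) * theta N α γ • siteSpin N n γ i),
    ← Finset.sum_sub_distrib, Finset.smul_sum]
  refine Finset.sum_congr rfl fun β _ => ?_
  rw [← Finset.sum_sub_distrib, Finset.sum_eq_single β]
  · rw [smul_mul_smul_comm, smul_mul_smul_comm, ← smul_sub, siteSpin_commutator, smul_comm, sq]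
  · intro γ _ h
    rw [smul_mul_smul_comm, smul_mul_smul_comm, siteSpin_commute h, mul_comm, sub_self]
  · simp

theorem dOp_eq (N n : ℕ) (α : Fin N) (i : Fin 3) : dOp N n α i = (1 / 2 : ℂ) •
    (Complex.I • crossOp (siteSpin N n α) (thetaSpin N n α) i
      + ((spin n : ℂ) + 1) • thetaSpin N n α i
      - (1 / ((spin n : ℂ) + 1)) •
        (siteSpin N n α i * ∑ j, siteSpin N n α j * thetaSpin N n α j)) := by
  rw [sum_siteSpin_mul_thetaSpin]
  simp only [dOp, crossOp, thetaSpin]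
  rw [Finset.sum_erase]
  · congr 1
    simp only [Finset.mul_sum, Finset.smul_sum, ← Finset.sum_sub_distrib, ← Finset.sum_add_distrib]
    refine Finset.sum_congr rfl fun β _ => ?_
    rw [← theta]
    push_cast
    simp only [mul_smul_comm]
    module
  · rw [← theta, theta_self, zero_smul]

/-- S_α is Hermitian, F_α is anti-Hermitian because θ is imaginary, and the two commute; this
produces the overall minus sign and reverses the order in the last term. -/
theorem dOp_conjTranspose (N n : ℕ) (α : Fin N) (i : Fin 3) : (dOp N n α i)ᴴ = (-(1 / 2) : ℂ) •
    (-(Complex.I • crossOp (siteSpin N n α) (thetaSpin N n α) i)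
      + ((spin n : ℂ) + 1) • thetaSpin N n α i
      - (1 / ((spin n : ℂ) + 1)) •
        ((∑ j, siteSpin N n α j * thetaSpin N n α j) * siteSpin N n α i)) := by
  have h1 : (crossOp (siteSpin N n α) (thetaSpin N n α) i)ᴴ =
      -crossOp (siteSpin N n α) (thetaSpin N n α) i := by
    simp only [crossOp, Matrix.conjTranspose_sub, Matrix.conjTranspose_mul,
      siteSpin_conjTranspose, thetaSpin_conjTranspose, neg_mul, thetaSpin_mul_siteSpin]
    abel
  have h2 : (∑ j, siteSpin N n α j * thetaSpin N n α j)ᴴ =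
      -∑ j, siteSpin N n α j * thetaSpin N n α j := by
    simp only [Matrix.conjTranspose_sum, Matrix.conjTranspose_mul,
      siteSpin_conjTranspose, thetaSpin_conjTranspose, neg_mul, thetaSpin_mul_siteSpin,
      Finset.sum_neg_distrib]
  have h3 : star ((spin n : ℂ) + 1) = (spin n : ℂ) + 1 := by simp
  have h4 : star (1 / ((spin n : ℂ) + 1)) = 1 / ((spin n : ℂ) + 1) := by simp
  have h5 : star (1 / 2 : ℂ) = 1 / 2 := by simp
  rw [dOp_eq, Matrix.conjTranspose_smul, Matrix.conjTranspose_sub, Matrix.conjTranspose_add,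
    Matrix.conjTranspose_smul, Matrix.conjTranspose_smul, Matrix.conjTranspose_smul,
    Matrix.conjTranspose_mul, h1, h2, h3, h4, h5, siteSpin_conjTranspose, thetaSpin_conjTranspose,
    Complex.star_def, Complex.conj_I, neg_mul]
  module

theorem spin_add_one_ne_zero (n : ℕ) : (spin n : ℂ) + 1 ≠ 0 := by
  rw [spin]
  norm_cast
  positivity

theorem dDaggerD_eq (N n : ℕ) (α : Fin N) : dDaggerD N n α = (-(2 * (spin n : ℂ) + 1) / 4) •
    (((spin n : ℂ) + 1) • (∑ i, thetaSpin N n α i * thetaSpin N n α i)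
      + (∑ β, theta N α β ^ 2 • spinDot N n α β)
      - (1 / ((spin n : ℂ) + 1)) • ((∑ β, theta N α β • spinDot N n α β) *
          ∑ β, theta N α β • spinDot N n α β)) := by
  have h := sum_projected_mul_projected (spin_add_one_ne_zero n)
    (thetaSpin_mul_siteSpin N n α) (siteSpin_commutator α)
    (G := fun i => ∑ β, theta N α β ^ 2 • siteSpin N n β i)
    (thetaSpin_commutator N n α) (by rw [sum_siteSpin_mul_self]; push_cast; rfl)
  have h1 : ∑ i, siteSpin N n α i * ∑ β, theta N α β ^ 2 • siteSpin N n β i =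
      ∑ β, theta N α β ^ 2 • spinDot N n α β := by
    simp only [spinDot_eq_sum, Finset.mul_sum, Finset.smul_sum, mul_smul_comm]
    exact Finset.sum_comm
  rw [h1, sum_siteSpin_mul_thetaSpin] at h
  simp only [dDaggerD, dOp_conjTranspose]
  simp only [dOp_eq, smul_mul_smul_comm, ← Finset.smul_sum, sum_siteSpin_mul_thetaSpin, crossOp]
  rw [h]
  module

/-- The difference t_γ − t_β is antisymmetric while the anticommutator is symmetric, so only the
factorized weight t_β t_γ contributes. -/
theorem sum_sum_antisymm_smul {ι A : Type*} [Ring A] [Algebra ℂ A] (s : Finset ι) (t : ι → ℂ)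
    (f : ι → A) (c : ℂ) :
    ∑ β ∈ s, ∑ γ ∈ s, (1 / 4 * (t γ - t β - t β * t γ)) • c • (f β * f γ + f γ * f β) =
      (-(c * (1 / 2))) • ((∑ β ∈ s, t β • f β) * ∑ β ∈ s, t β • f β) := by
  have e : ∀ β γ, (1 / 4 * (t γ - t β - t β * t γ)) • c • (f β * f γ + f γ * f β) =
      (c / 4) • (f β * t γ • f γ + t γ • f γ * f β - t β • f β * f γ - f γ * t β • f β
        - t β • f β * t γ • f γ - t γ • f γ * t β • f β) := by
    intro β γ
    simp only [smul_mul_assoc, mul_smul_comm]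
    module
  simp only [e, ← Finset.smul_sum, Finset.sum_sub_distrib, Finset.sum_add_distrib,
    ← Finset.mul_sum, ← Finset.sum_mul]
  module

theorem hTilde_eq (N n : ℕ) : hTilde N n = ((2 * Real.pi ^ 2 / (N : ℝ) ^ 2 : ℝ) : ℂ) •
    ((-(1 / 4) : ℂ) • (∑ α, ∑ β, theta N α β ^ 2 • spinDot N n α β)
      + (1 / (4 * ((spin n : ℂ) + 1) * (2 * spin n + 3))) •
        ∑ α, (∑ β, theta N α β • spinDot N n α β) * ∑ β, theta N α β • spinDot N n α β) := by
  rw [hTilde]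
  congr 1
  rw [sub_eq_add_neg]
  congr 1
  · rw [Finset.smul_sum]
    refine Finset.sum_congr rfl fun α _ => ?_
    rw [Finset.smul_sum, ← Finset.sum_erase Finset.univ (a := α)]
    · refine Finset.sum_congr rfl fun β hβ => ?_
      rw [inv_norm_sq_sub_quarter (Finset.ne_of_mem_erase hβ).symm, smul_smul]
    · simp
  · rw [← Finset.sum_neg_distrib, Finset.smul_sum]
    refine Finset.sum_congr rfl fun α _ => ?_
    set c : ℂ := ((1 / (2 * (spin n + 1) * (2 * spin n + 3)) : ℝ) : ℂ) with hc
    have hc' : 1 / (4 * ((spin n : ℂ) + 1) * (2 * spin n + 3)) = 1 / 2 * c := by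
      rw [hc]
      push_cast
      rw [one_div_mul_one_div]
      congr 1
      ring
    rw [hc']
    rw [← Finset.sum_erase (f := fun β => theta N α β • spinDot N n α β) Finset.univ (a := α)
      (by simp), mul_comm (1 / 2) c, ← neg_inj, neg_neg, ← neg_smul,
      ← sum_sum_antisymm_smul (Finset.univ.erase α)]
    refine Finset.sum_congr rfl fun β hβ => Finset.sum_congr rfl fun γ hγ => ?_
    rw [inv_mul_sub_quarter (Finset.ne_of_mem_erase hβ).symm (Finset.ne_of_mem_erase hγ).symm]

theorem sum_sum_siteSpin_dot (N n : ℕ) :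
    ∑ α, ∑ i, thetaSpin N n α i * thetaSpin N n α i =
      ((N : ℂ) - 2) • (totalSpin N n ⬝ᵥ totalSpin N n)
        + (2 : ℂ) • (∑ α, ∑ β, theta N α β ^ 2 • spinDot N n α β)
        - ((N : ℂ) * (N - 2) * (N + 2) / 3 * (spin n * (spin n + 1))) • (1 : Op N n) := by
  have h2 : ∑ α, ∑ i, thetaSpin N n α i * thetaSpin N n α i =
      ∑ β, ∑ γ, (∑ α, theta N α β * theta N α γ) • spinDot N n β γ := by
    simp only [thetaSpin, spinDot_eq_sum, Finset.sum_smul, Finset.smul_sum, Finset.sum_mul_sum,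
      smul_mul_smul_comm]
    rw [Finset.sum_congr rfl fun α _ => Finset.sum_comm, Finset.sum_comm]
    refine Finset.sum_congr rfl fun β _ => ?_
    rw [Finset.sum_congr rfl fun α _ => Finset.sum_comm, Finset.sum_comm]
    exact Finset.sum_congr rfl fun γ _ => Finset.sum_comm
  have h3 : totalSpin N n ⬝ᵥ totalSpin N n = ∑ β, ∑ γ, spinDot N n β γ := by
    simp only [totalSpin, spinDot, sum_dotProduct, dotProduct_sum]
    exact Finset.sum_comm
  have h4 : ∀ β : Fin N, spinDot N n β β = ((spin n : ℂ) * (spin n + 1)) • (1 : Op N n) := by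
    intro β
    rw [spinDot_eq_sum, sum_siteSpin_mul_self]
    push_cast
    rfl
  rw [h2, h3]
  simp only [sum_theta_mul_theta_ite, add_smul, Finset.sum_add_distrib, ite_smul, zero_smul,
    Finset.sum_ite_eq, Finset.mem_univ, if_true, h4, ← Finset.smul_sum, mul_smul]
  rw [← Finset.sum_smul, Finset.sum_sub_distrib, sum_sum_theta_sq]
  simp only [Finset.sum_const, Finset.card_univ, Fintype.card_fin, nsmul_eq_mul]
  module

/-- The S_tot² contributions cancel by the choice of the second coefficient on the left. The sum ∑θ²
S·S appears with weight 2(S+1)+1 = 2S+3, which cancels the denominator, and the constant is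
N(N²−4)/3 up to spin factors, which gives the energy. -/
theorem operator_identity (N n : ℕ) (hN : 1 ≤ N) :
    ((2 * Real.pi ^ 2 / (N : ℝ) ^ 2 : ℝ) : ℂ) •
        (((1 / ((2 * spin n + 1) * (2 * spin n + 3)) : ℝ) : ℂ) • ∑ α, dDaggerD N n α
          + (((spin n + 1) * ((N : ℝ) - 2) / (4 * (2 * spin n + 3)) : ℝ) : ℂ) •
            (totalSpin N n ⬝ᵥ totalSpin N n))
      = hTilde N n - ((eTilde N n : ℝ) : ℂ) • (1 : Op N n) := by
  have h1 : (spin n : ℂ) + 1 ≠ 0 := spin_add_one_ne_zero n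
  have h2 : 2 * (spin n : ℂ) + 1 ≠ 0 := by rw [spin]; norm_cast; positivity
  have h3 : 2 * (spin n : ℂ) + 3 ≠ 0 := by rw [spin]; norm_cast; positivity
  have h4 : (N : ℂ) ≠ 0 := by exact_mod_cast (by omega : N ≠ 0)
  simp only [hTilde_eq, dDaggerD_eq, ← Finset.smul_sum, Finset.sum_sub_distrib,
    Finset.sum_add_distrib, sum_sum_siteSpin_dot, eTilde]
  push_cast
  match_scalars
  · field_simp
    ring
  · field_simp
    ring
  · field_simp
    ring
  · field_simp

/-! ### Spin operators on the Fock space -/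

section Fock

open MvPolynomial

/-- The operator `∑_β f_β a†_β b_β = ∑_β f_β S⁺_β`. -/
def fockPlus {N : ℕ} (f : Fin N → ℂ) : Derivation ℂ (Fock N) (Fock N) :=
  mkDerivation ℂ (Sum.elim (fun _ => 0) fun β => f β • X (Sum.inl β))

/-- The operator `∑_β f_β b†_β a_β = ∑_β f_β S⁻_β`. -/
def fockMinus {N : ℕ} (f : Fin N → ℂ) : Derivation ℂ (Fock N) (Fock N) :=
  mkDerivation ℂ (Sum.elim (fun β => f β • X (Sum.inr β)) fun _ => 0)

/-- The operator `½ ∑_β f_β (a†_β a_β - b†_β b_β) = ∑_β f_β S^z_β`. -/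
def fockZ {N : ℕ} (f : Fin N → ℂ) : Derivation ℂ (Fock N) (Fock N) :=
  mkDerivation ℂ (Sum.elim (fun β => (f β / 2) • X (Sum.inl β))
    fun β => (-(f β / 2)) • X (Sum.inr β))

/-- The operator `∑_β f_β (a†_β a_β + b†_β b_β)`. -/
def fockNumber {N : ℕ} (f : Fin N → ℂ) : Derivation ℂ (Fock N) (Fock N) :=
  mkDerivation ℂ (Sum.elim (fun β => f β • X (Sum.inl β)) fun β => f β • X (Sum.inr β))

variable {N : ℕ} (f g : Fin N → ℂ) (P : Fock N)

/-- The commutator of two derivations is a derivation, so commutation relations need checking only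
on the generators. -/
theorem derivation_comm_of_X {D E F : Derivation ℂ (Fock N) (Fock N)}
    (h : ∀ i, D (E (X i)) - E (D (X i)) = F (X i)) : D (E P) = E (D P) + F P := by
  have : ⁅D, E⁆ = F := derivation_ext fun i => by rw [Derivation.commutator_apply, h]
  rw [← this, Derivation.commutator_apply]
  abel

theorem fockPlus_fockMinus : fockPlus f (fockMinus g P) =
    fockMinus g (fockPlus f P) + (2 : ℂ) • fockZ (f * g) P := by
  refine derivation_comm_of_X (F := (2 : ℂ) • fockZ (f * g)) P fun i => ?_
  rcases i with β | β <;> simp [fockPlus, fockMinus, fockZ, smul_smul] <;> ring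

theorem fockPlus_fockZ : fockPlus f (fockZ g P) =
    fockZ g (fockPlus f P) - fockPlus (f * g) P := by
  rw [sub_eq_add_neg]
  refine derivation_comm_of_X (F := -fockPlus (f * g)) P fun i => ?_
  rcases i with β | β <;> simp [fockPlus, fockZ, smul_smul]
  module

theorem fockPlus_fockPlus : fockPlus f (fockPlus g P) = fockPlus g (fockPlus f P) := by
  rw [← add_zero (fockPlus g (fockPlus f P))]
  refine derivation_comm_of_X (F := 0) P fun i => ?_
  rcases i with β | β <;> simp [fockPlus]

theorem fockNumber_fockPlus : fockNumber f (fockPlus g P) = fockPlus g (fockNumber f P) := by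
  rw [← add_zero (fockPlus _ (fockNumber _ P))]
  refine derivation_comm_of_X (F := 0) P fun i => ?_
  rcases i with β | β <;> simp [fockPlus, fockNumber, smul_smul, mul_comm]

theorem fockNumber_fockMinus : fockNumber f (fockMinus g P) = fockMinus g (fockNumber f P) := by
  rw [← add_zero (fockMinus _ (fockNumber _ P))]
  refine derivation_comm_of_X (F := 0) P fun i => ?_
  rcases i with β | β <;> simp [fockMinus, fockNumber, smul_smul, mul_comm]

theorem fockNumber_fockZ : fockNumber f (fockZ g P) = fockZ g (fockNumber f P) := by
  rw [← add_zero (fockZ _ (fockNumber _ P))]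
  refine derivation_comm_of_X (F := 0) P fun i => ?_
  rcases i with β | β <;> simp [fockZ, fockNumber, smul_smul, mul_comm]

variable {f}

theorem pderiv_fockPlus {α : Fin N} (h : f α = 0) (i : Fin N ⊕ Fin N)
    (hi : i = Sum.inl α ∨ i = Sum.inr α) : pderiv i (fockPlus f P) = fockPlus f (pderiv i P) := by
  rw [← add_zero (fockPlus f (pderiv i P))]
  refine derivation_comm_of_X (F := 0) P fun j => ?_
  rcases j with β | β <;> rcases eq_or_ne β α with rfl | hβ <;> rcases hi with rfl | rfl <;>
    simp_all [fockPlus, pderiv_X]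

theorem pderiv_fockMinus {α : Fin N} (h : f α = 0) (i : Fin N ⊕ Fin N)
    (hi : i = Sum.inl α ∨ i = Sum.inr α) :
    pderiv i (fockMinus f P) = fockMinus f (pderiv i P) := by
  rw [← add_zero (fockMinus f (pderiv i P))]
  refine derivation_comm_of_X (F := 0) P fun j => ?_
  rcases j with β | β <;> rcases eq_or_ne β α with rfl | hβ <;> rcases hi with rfl | rfl <;>
    simp_all [fockMinus, pderiv_X]

variable (f)

theorem derivation_eq_sum {σ : Type*} [Fintype σ]
    (D : Derivation ℂ (MvPolynomial σ ℂ) (MvPolynomial σ ℂ)) (P : MvPolynomial σ ℂ) :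
    D P = ∑ i, D (X i) * pderiv i P := by
  classical
  have hs : ∀ (s : Finset σ) (Q : MvPolynomial σ ℂ),
      (∑ i ∈ s, D (X i) • pderiv (R := ℂ) i) Q = ∑ i ∈ s, D (X i) * pderiv i Q := by
    intro s Q
    induction s using Finset.induction_on with
    | empty => simp
    | insert i s hi ih => rw [Finset.sum_insert hi, Finset.sum_insert hi, Derivation.add_apply, ih,
        Derivation.smul_apply, smul_eq_mul]
  have h : D = ∑ i, D (X i) • pderiv (R := ℂ) i := by
    refine derivation_ext fun j => ?_
    rw [hs, Finset.sum_eq_single j]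
    · simp
    · intro i _ hi
      rw [pderiv_X_of_ne hi.symm, mul_zero]
    · simp
  rw [← hs, ← h]

theorem fockPlus_eq_sum : fockPlus f P = ∑ β, f β • (X (Sum.inl β) * pderiv (Sum.inr β) P) := by
  rw [derivation_eq_sum]
  simp [fockPlus]

theorem fockMinus_eq_sum : fockMinus f P = ∑ β, f β • (X (Sum.inr β) * pderiv (Sum.inl β) P) := by
  rw [derivation_eq_sum]
  simp [fockMinus]

theorem fockZ_eq_sum : fockZ f P = ∑ β, f β • ((1 / 2 : ℂ) •
    (X (Sum.inl β) * pderiv (Sum.inl β) P - X (Sum.inr β) * pderiv (Sum.inr β) P)) := by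
  rw [derivation_eq_sum, Fintype.sum_sum_type, ← Finset.sum_add_distrib]
  refine Finset.sum_congr rfl fun β _ => ?_
  simp only [fockZ, mkDerivation_X, Sum.elim_inl, Sum.elim_inr, smul_mul_assoc]
  module

theorem fockNumber_eq_sum : fockNumber f P = ∑ β, f β •
    (X (Sum.inl β) * pderiv (Sum.inl β) P + X (Sum.inr β) * pderiv (Sum.inr β) P) := by
  rw [derivation_eq_sum, Fintype.sum_sum_type, ← Finset.sum_add_distrib]
  refine Finset.sum_congr rfl fun β _ => ?_
  simp only [fockNumber, mkDerivation_X, Sum.elim_inl, Sum.elim_inr, smul_mul_assoc]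
  module

theorem fockNumber_single (α : Fin N) (P : Fock N) : fockNumber (Pi.single α 1) P =
    X (Sum.inl α) * pderiv (Sum.inl α) P + X (Sum.inr α) * pderiv (Sum.inr α) P := by
  rw [fockNumber_eq_sum, Finset.sum_eq_single α]
  · simp
  · intro β _ h
    simp [h]
  · simp

theorem coeff_X_mul_pderiv {σ : Type*} (i : σ) (P : MvPolynomial σ ℂ) (m : σ →₀ ℕ) :
    coeff m (X i * pderiv i P) = (m i : ℂ) * coeff m P := by
  classical
  rw [coeff_X_mul']
  split_ifs with h
  · rw [Finsupp.mem_support_iff] at h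
    rw [coeff_pderiv, tsub_add_cancel_of_le (Finsupp.single_le_iff.2 (Nat.one_le_iff_ne_zero.2 h)),
      Finsupp.tsub_apply, Finsupp.single_eq_same, Nat.cast_sub (Nat.one_le_iff_ne_zero.2 h)]
    push_cast
    ring
  · rw [Finsupp.notMem_support_iff.1 h]
    simp

theorem coeff_fockNumber_single (α : Fin N) (P : Fock N) (m : (Fin N ⊕ Fin N) →₀ ℕ) :
    coeff m (fockNumber (Pi.single α 1) P) =
      ((m (Sum.inl α) : ℂ) + m (Sum.inr α)) * coeff m P := by
  rw [fockNumber_single, coeff_add, coeff_X_mul_pderiv, coeff_X_mul_pderiv, add_mul]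

/-- A polynomial with no bosons at α does not involve the variables of α. -/
theorem pderiv_eq_zero_of_fockNumber {α : Fin N} {P : Fock N}
    (h : fockNumber (Pi.single α 1) P = 0) (i : Fin N ⊕ Fin N)
    (hi : i = Sum.inl α ∨ i = Sum.inr α) : pderiv i P = 0 := by
  ext m
  rw [coeff_pderiv, coeff_zero]
  have h1 := coeff_fockNumber_single α P (m + Finsupp.single i 1)
  rw [h, coeff_zero, eq_comm, mul_eq_zero] at h1
  rcases h1 with h1 | h1
  · exfalso
    norm_cast at h1
    rcases hi with rfl | rfl <;> simp at h1
  · rw [h1, zero_mul]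

theorem pderiv_pderiv_comm (i j : Fin N ⊕ Fin N) (P : Fock N) :
    pderiv i (pderiv j P) = pderiv j (pderiv i P) := by
  rw [← add_zero (pderiv j (pderiv i P))]
  refine derivation_comm_of_X (F := 0) P fun k => ?_
  simp only [pderiv_X, Pi.single_apply, Derivation.zero_apply]
  split_ifs <;> simp

/-- A linear polynomial in the variables of the site `α`, applied to a singlet: the vanishing of
the highest component implies the vanishing of the whole spin-`3/2` multiplet. -/
theorem spin_multiplet_eq_zero {α : Fin N} {t : Fin N → ℂ} (ht : t α = 0) {P : Fock N}
    (hP : fockNumber (Pi.single α 1) P = P) (hplus : fockPlus 1 P = 0)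
    (htop : fockMinus t (pderiv (Sum.inl α) P) = 0) :
    X (Sum.inl α) ^ 2 * fockMinus t P - X (Sum.inr α) ^ 2 * fockPlus t P
      - 2 * X (Sum.inl α) * X (Sum.inr α) * fockZ t P = 0 := by
  set a : Fock N := X (Sum.inl α) with ha
  set b : Fock N := X (Sum.inr α) with hb
  set U := pderiv (Sum.inl α) P with hU
  set V := pderiv (Sum.inr α) P with hV
  have hP' : P = a * U + b * V := by rw [← hP, fockNumber_single]
  have haU : fockNumber (Pi.single α 1) U = 0 := by
    have h1 : U = pderiv (Sum.inl α) (a * U + b * V) := by rw [← hP']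
    have hs : pderiv (Sum.inl α) V = pderiv (Sum.inr α) U := pderiv_pderiv_comm _ _ _
    rw [Derivation.map_add, pderiv_mul, pderiv_mul, ha, hb, pderiv_X_self,
      pderiv_X_of_ne (by simp), hs] at h1
    rw [fockNumber_single]
    linear_combination -h1
  have haV : fockNumber (Pi.single α 1) V = 0 := by
    have h1 : V = pderiv (Sum.inr α) (a * U + b * V) := by rw [← hP']
    have hs : pderiv (Sum.inl α) V = pderiv (Sum.inr α) U := pderiv_pderiv_comm _ _ _
    rw [Derivation.map_add, pderiv_mul, pderiv_mul, ha, hb, pderiv_X_self,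
      pderiv_X_of_ne (by simp), ← hs] at h1
    rw [fockNumber_single]
    linear_combination -h1
  -- The weight r selects all sites except α, so `fockPlus r` is the total raising operator R of the
  -- rest of the chain.
  set r : Fin N → ℂ := 1 - Pi.single α 1 with hr
  have hrα : r α = 0 := by simp [hr]
  have hrt : r * t = t := by
    ext β
    rcases eq_or_ne β α with rfl | h
    · simp [ht]
    · simp [hr, h]
  have hplus' : fockPlus r P + a * V = 0 := by
    rw [← hplus, fockPlus_eq_sum, fockPlus_eq_sum]
    simp only [hr, Pi.sub_apply, sub_smul, Finset.sum_sub_distrib, Pi.one_apply]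
    rw [Finset.sum_eq_single (s := Finset.univ) (f := fun β => (Pi.single α 1 : Fin N → ℂ) β •
      (X (Sum.inl β) * pderiv (Sum.inr β) P)) α]
    · simp [ha, hV]
    · intro β _ h
      simp [h]
    · simp
  have hVa := pderiv_eq_zero_of_fockNumber haV (Sum.inl α) (Or.inl rfl)
  have hVb := pderiv_eq_zero_of_fockNumber haV (Sum.inr α) (Or.inr rfl)
  -- Comparing coefficients of a and b in the singlet condition R(aU + bV) + aV = 0 gives RU = −V
  -- and RV = 0.
  have hRU : fockPlus r U = -V := by
    have h1 := congrArg (pderiv (Sum.inl α)) hplus'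
    rw [Derivation.map_add, pderiv_fockPlus _ hrα _ (Or.inl rfl), pderiv_mul, hVa, ha,
      pderiv_X_self, Derivation.map_zero] at h1
    linear_combination h1
  have hRV : fockPlus r V = 0 := by
    have h1 := congrArg (pderiv (Sum.inr α)) hplus'
    rw [Derivation.map_add, pderiv_fockPlus _ hrα _ (Or.inr rfl), pderiv_mul, hVb, ha,
      pderiv_X_of_ne (by simp), Derivation.map_zero] at h1
    linear_combination h1
  -- Applying R repeatedly to F⁻U = 0 runs through the multiplet. The results are the a²b, ab² and
  -- b³ coefficients of the claimed polynomial, whose a³ coefficient is F⁻U itself.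
  have e1 : fockMinus t V = (2 : ℂ) • fockZ t U := by
    have h1 := fockPlus_fockMinus r t U
    rw [htop, Derivation.map_zero, hRU, Derivation.map_neg, hrt] at h1
    linear_combination (norm := module) h1
  have e2 : fockPlus t U = (-2 : ℂ) • fockZ t V := by
    have h1 := congrArg (fockPlus r) e1
    rw [fockPlus_fockMinus, hRV, Derivation.map_zero, hrt, Derivation.map_smul, fockPlus_fockZ,
      hRU, hrt, Derivation.map_neg] at h1
    linear_combination (norm := module) (1 / 2 : ℂ) • h1
  have e3 : fockPlus t V = 0 := by
    have h1 := congrArg (fockPlus r) e2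
    rw [fockPlus_fockPlus, hRU, Derivation.map_smul, fockPlus_fockZ, hRV, Derivation.map_zero, hrt,
      Derivation.map_neg] at h1
    -- The relation reads −F⁺V = 2F⁺V.
    linear_combination (norm := module) (-1 / 3 : ℂ) • h1
  have hta : fockMinus t a = 0 ∧ fockPlus t a = 0 ∧ fockZ t a = 0 := by
    simp [ha, fockMinus, fockPlus, fockZ, ht]
  have htb : fockMinus t b = 0 ∧ fockPlus t b = 0 ∧ fockZ t b = 0 := by
    simp [hb, fockMinus, fockPlus, fockZ, ht]
  rw [hP']
  simp only [Derivation.map_add, Derivation.leibniz, hta, htb, htop, e1, e2, e3, smul_eq_mul,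
    mul_zero, add_zero, zero_add, smul_eq_C_mul]
  simp only [map_neg, map_ofNat]
  ring

end Fock

/-! ### The Haldane–Shastry polynomial -/

section Fock

open MvPolynomial

variable {N : ℕ}

/-- The monomial of the configuration with up spins on `Z` and down spins elsewhere. -/
def configPoly (Z : Finset (Fin N)) : Fock N :=
  (∏ α ∈ Z, X (Sum.inl α)) * ∏ α ∈ Zᶜ, X (Sum.inr α)

theorem hsPoly_eq (N : ℕ) : hsPoly N =
    ∑ Z ∈ (Finset.univ : Finset (Fin N)).powersetCard (N / 2), hsAmplitude N Z • configPoly Z := by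
  simp only [hsPoly, configPoly, smul_eq_C_mul]

theorem derivation_prod {ι : Type*} [DecidableEq ι] (D : Derivation ℂ (Fock N) (Fock N))
    (s : Finset ι) (g : ι → Fock N) :
    D (∏ i ∈ s, g i) = ∑ i ∈ s, (∏ j ∈ s.erase i, g j) * D (g i) := by
  induction s using Finset.induction_on with
  | empty => simp
  | insert i s hi ih =>
    rw [Finset.prod_insert hi, Derivation.leibniz, ih, Finset.sum_insert hi,
      Finset.erase_insert hi, smul_eq_mul, smul_eq_mul, Finset.mul_sum, add_comm]
    congr 1
    refine Finset.sum_congr rfl fun j hj => ?_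
    have hij : i ≠ j := fun h => hi (h ▸ hj)
    rw [Finset.erase_insert_of_ne hij, Finset.prod_insert fun h => hi (Finset.mem_of_mem_erase h),
      mul_assoc]

theorem derivation_prod_of_eigen {ι : Type*} [DecidableEq ι] (D : Derivation ℂ (Fock N) (Fock N))
    (s : Finset ι) (g : ι → Fock N) (w : ι → ℂ) (h : ∀ i, D (g i) = w i • g i) :
    D (∏ i ∈ s, g i) = (∑ i ∈ s, w i) • ∏ i ∈ s, g i := by
  rw [derivation_prod, Finset.sum_smul]
  refine Finset.sum_congr rfl fun i hi => ?_
  rw [h, mul_smul_comm, Finset.prod_erase_mul _ _ hi]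

theorem fockZ_configPoly (f : Fin N → ℂ) (Z : Finset (Fin N)) : fockZ f (configPoly Z) =
    ((∑ α ∈ Z, f α / 2) - ∑ α ∈ Zᶜ, f α / 2) • configPoly Z := by
  rw [configPoly, Derivation.leibniz,
    derivation_prod_of_eigen _ _ _ (fun α => -(f α / 2)) (by simp [fockZ]),
    derivation_prod_of_eigen _ _ _ (fun α => f α / 2) (by simp [fockZ]),
    Finset.sum_neg_distrib, smul_eq_mul, smul_eq_mul, mul_smul_comm, mul_smul_comm]
  rw [mul_comm (∏ α ∈ Z, X (Sum.inl α))]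
  module

theorem fockNumber_configPoly (f : Fin N → ℂ) (Z : Finset (Fin N)) :
    fockNumber f (configPoly Z) = (∑ α, f α) • configPoly Z := by
  rw [configPoly, Derivation.leibniz,
    derivation_prod_of_eigen _ _ _ f (by simp [fockNumber]),
    derivation_prod_of_eigen _ _ _ f (by simp [fockNumber]),
    ← Finset.sum_add_sum_compl Z f, smul_eq_mul, smul_eq_mul, mul_smul_comm, mul_smul_comm]
  rw [mul_comm (∏ α ∈ Z, X (Sum.inl α))]
  module

theorem fockMinus_configPoly (f : Fin N → ℂ) (Z : Finset (Fin N)) :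
    fockMinus f (configPoly Z) = ∑ β ∈ Z, f β • configPoly (Z.erase β) := by
  rw [configPoly, Derivation.leibniz,
    derivation_prod_of_eigen _ Zᶜ _ (fun _ => 0) (by simp [fockMinus]), derivation_prod,
    Finset.sum_const_zero, zero_smul, smul_zero, zero_add, smul_eq_mul, Finset.mul_sum]
  refine Finset.sum_congr rfl fun β hβ => ?_
  rw [configPoly, Finset.compl_erase, Finset.prod_insert (by simpa using hβ), fockMinus,
    mkDerivation_X, Sum.elim_inl, mul_smul_comm, mul_smul_comm]
  congr 1
  ring

theorem pderiv_inl_configPoly {α : Fin N} {Z : Finset (Fin N)} (h : α ∉ Z) :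
    pderiv (Sum.inl α) (configPoly Z) = 0 := by
  rw [configPoly, Derivation.leibniz, derivation_prod, derivation_prod, Finset.sum_eq_zero,
    Finset.sum_eq_zero, smul_zero, smul_zero, add_zero]
  · intro β hβ
    rw [pderiv_X_of_ne (by rintro ⟨⟩; exact h hβ), mul_zero]
  · intro β hβ
    rw [pderiv_X_of_ne (by simp), mul_zero]

/-- The differences are squared, so the ordering of the pairs is irrelevant and the amplitude
factorizes when a site is added. -/
theorem hsAmplitude_insert {β : Fin N} {Y : Finset (Fin N)} (h : β ∉ Y) :
    hsAmplitude N (insert β Y) =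
      hsAmplitude N Y * (site N β * ∏ γ ∈ Y, (site N β - site N γ) ^ 2) := by
  have key : ∏ γ ∈ Y, (site N β - site N γ) ^ 2 =
      (∏ γ ∈ Y, if β < γ then (site N β - site N γ) ^ 2 else 1) *
        ∏ γ ∈ Y, if γ < β then (site N γ - site N β) ^ 2 else 1 := by
    rw [← Finset.prod_mul_distrib]
    refine Finset.prod_congr rfl fun γ hγ => ?_
    rcases lt_trichotomy β γ with h1 | h1 | h1
    · simp [h1, h1.not_gt]
    · exact absurd (h1 ▸ hγ) h
    · rw [if_neg h1.not_gt, if_pos h1]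
      ring
  rw [hsAmplitude, hsAmplitude, key, Finset.prod_filter, Finset.prod_filter, Finset.prod_product,
    Finset.prod_product, Finset.prod_insert h, Finset.prod_insert h, Finset.prod_insert h]
  simp only [lt_self_iff_false, if_false, Finset.prod_insert h, Finset.prod_mul_distrib]
  ring

theorem hsAmplitude_ne_zero (Z : Finset (Fin N)) : hsAmplitude N Z ≠ 0 := by
  induction Z using Finset.induction_on with
  | empty => simp [hsAmplitude]
  | insert β Y h ih =>
    rw [hsAmplitude_insert h]
    refine mul_ne_zero ih (mul_ne_zero (site_ne_zero N β) (Finset.prod_ne_zero_iff.2 ?_))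
    exact fun γ hγ => pow_ne_zero _ (site_sub_ne_zero fun h' => h (h' ▸ hγ))

/-- Lowering Z at β leaves Y = Z \ {β}, so the terms are regrouped by Y. The inner sum may run over
all sites because its summand vanishes for β ∈ Y. -/
theorem fockMinus_hsPoly (hN : 1 ≤ N / 2) (f : Fin N → ℂ) : fockMinus f (hsPoly N) =
    ∑ Y ∈ (Finset.univ : Finset (Fin N)).powersetCard (N / 2 - 1),
      (hsAmplitude N Y * ∑ β, f β * (site N β * ∏ γ ∈ Y, (site N β - site N γ) ^ 2)) •
        configPoly Y := by
  have h1 : ∀ Y : Finset (Fin N),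
      ∑ β, f β * (site N β * ∏ γ ∈ Y, (site N β - site N γ) ^ 2) =
        ∑ β ∈ Yᶜ, f β * (site N β * ∏ γ ∈ Y, (site N β - site N γ) ^ 2) := by
    intro Y
    symm
    refine Finset.sum_subset (Finset.subset_univ _) fun β _ hβ => ?_
    rw [Finset.prod_eq_zero (i := β) (by simpa using hβ) (by simp), mul_zero, mul_zero]
  simp only [h1, Finset.mul_sum, Finset.sum_smul]
  rw [hsPoly_eq, map_sum]
  simp only [Derivation.map_smul, fockMinus_configPoly, Finset.smul_sum]
  rw [Finset.sum_sigma', Finset.sum_sigma']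
  refine Finset.sum_bij' (fun x _ => ⟨x.1.erase x.2, x.2⟩) (fun x _ => ⟨insert x.2 x.1, x.2⟩)
    ?_ ?_ ?_ ?_ ?_
  · rintro ⟨Z, β⟩ hx
    simp only [Finset.mem_sigma, Finset.mem_powersetCard_univ] at hx ⊢
    exact ⟨by rw [Finset.card_erase_of_mem hx.2, hx.1], by simp⟩
  · rintro ⟨Y, β⟩ hx
    simp only [Finset.mem_sigma, Finset.mem_powersetCard_univ, Finset.mem_compl] at hx ⊢
    exact ⟨by rw [Finset.card_insert_of_notMem hx.2, hx.1]; omega, by simp⟩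
  · rintro ⟨Z, β⟩ hx
    simp only [Finset.mem_sigma] at hx
    simp [Finset.insert_erase hx.2]
  · rintro ⟨Y, β⟩ hx
    simp only [Finset.mem_sigma, Finset.mem_compl] at hx
    simp [Finset.erase_insert hx.2]
  · rintro ⟨Z, β⟩ hx
    simp only [Finset.mem_sigma] at hx
    simp only [smul_smul]
    congr 1
    nth_rewrite 1 [← Finset.insert_erase hx.2]
    rw [hsAmplitude_insert (Finset.notMem_erase β Z)]
    ring

open Polynomial in
theorem natDegree_prod_X_sub_C_sq (Y : Finset (Fin N)) :
    (∏ γ ∈ Y, (Polynomial.X - Polynomial.C (site N γ)) ^ 2).natDegree = 2 * Y.card := by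
  rw [Polynomial.natDegree_prod_of_monic _ _ fun γ _ => (Polynomial.monic_X_sub_C _).pow 2]
  simp [mul_comm]

/-- With |Y| = M−1 each coefficient is the sum over the sites of z∏(z−η_γ)², a polynomial of degree
2M−1 = N−1 without constant term. -/
theorem fockMinus_one_hsPoly (hN : 1 ≤ N) (he : Even N) : fockMinus 1 (hsPoly N) = 0 := by
  obtain ⟨M, hM⟩ := he
  rw [fockMinus_hsPoly (by omega)]
  refine Finset.sum_eq_zero fun Y hY => ?_
  rw [Finset.mem_powersetCard_univ] at hY
  have h := sum_eval_site (N := N) (Polynomial.X *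
    ∏ γ ∈ Y, (Polynomial.X - Polynomial.C (site N γ)) ^ 2) (by simp) (by
      refine lt_of_le_of_lt Polynomial.natDegree_mul_le ?_
      rw [natDegree_prod_X_sub_C_sq, Polynomial.natDegree_X]
      omega)
  simp only [Polynomial.eval_mul, Polynomial.eval_X, Polynomial.eval_prod, Polynomial.eval_pow,
    Polynomial.eval_sub, Polynomial.eval_C] at h
  simp [h]

/-- Only sets Y containing α survive the derivative. For them the double zero at η_α absorbs the
pole of θ: (z−η_α)² is replaced, up to sign, by (z+η_α)(z−η_α), so the degree remains N−1 and the
same vanishing sum applies. -/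
theorem fockMinus_theta_pderiv_hsPoly (hN : 1 ≤ N) (he : Even N) (α : Fin N) :
    fockMinus (theta N α) (pderiv (Sum.inl α) (hsPoly N)) = 0 := by
  obtain ⟨M, hM⟩ := he
  rw [← pderiv_fockMinus _ (theta_self α) _ (Or.inl rfl), fockMinus_hsPoly (by omega), map_sum]
  refine Finset.sum_eq_zero fun Y hY => ?_
  rw [Finset.mem_powersetCard_univ] at hY
  rw [Derivation.map_smul]
  by_cases hα : α ∈ Y
  · have hc : (Y.erase α).card + 2 = M := by
      have := Finset.card_erase_add_one hα
      omega
    have h := sum_eval_site (N := N) (Polynomial.X * ((Polynomial.X + Polynomial.C (site N α)) *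
      (Polynomial.X - Polynomial.C (site N α)) *
      ∏ γ ∈ Y.erase α, (Polynomial.X - Polynomial.C (site N γ)) ^ 2)) (by simp) (by
        refine lt_of_le_of_lt Polynomial.natDegree_mul_le ?_
        have h1 := Polynomial.natDegree_mul_le (p := (Polynomial.X + Polynomial.C (site N α)) *
          (Polynomial.X - Polynomial.C (site N α)))
          (q := ∏ γ ∈ Y.erase α, (Polynomial.X - Polynomial.C (site N γ)) ^ 2)
        have h2 := Polynomial.natDegree_mul_le (p := Polynomial.X + Polynomial.C (site N α))
          (q := Polynomial.X - Polynomial.C (site N α))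
        rw [natDegree_prod_X_sub_C_sq] at h1
        rw [Polynomial.natDegree_X_add_C, Polynomial.natDegree_X_sub_C] at h2
        rw [Polynomial.natDegree_X]
        omega)
    simp only [Polynomial.eval_mul, Polynomial.eval_X, Polynomial.eval_prod, Polynomial.eval_pow,
      Polynomial.eval_sub, Polynomial.eval_add, Polynomial.eval_C] at h
    have h' : ∑ β, theta N α β * (site N β * ∏ γ ∈ Y, (site N β - site N γ) ^ 2) = 0 := by
      rw [← neg_eq_zero, ← Finset.sum_neg_distrib, ← h]
      refine Finset.sum_congr rfl fun β _ => ?_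
      rw [← Finset.mul_prod_erase _ _ hα]
      rcases eq_or_ne α β with rfl | hβ
      · simp
      · have := site_sub_ne_zero hβ
        rw [theta]
        field_simp
        ring
    rw [h', mul_zero, zero_smul]
  · rw [pderiv_inl_configPoly hα, smul_zero]

theorem fockZ_one_hsPoly (he : Even N) : fockZ 1 (hsPoly N) = 0 := by
  obtain ⟨M, hM⟩ := he
  rw [hsPoly_eq, map_sum]
  refine Finset.sum_eq_zero fun Z hZ => ?_
  rw [Finset.mem_powersetCard_univ] at hZ
  have h1 : Zᶜ.card = Z.card := by
    rw [Finset.card_compl, Fintype.card_fin]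
    omega
  rw [Derivation.map_smul, fockZ_configPoly]
  simp [h1]

theorem fockNumber_hsPoly (α : Fin N) : fockNumber (Pi.single α 1) (hsPoly N) = hsPoly N := by
  simp only [hsPoly_eq, map_sum, Derivation.map_smul, fockNumber_configPoly]
  simp

/-- Evaluating at the indicator point of a set Z₀ of size N/2 leaves only the monomial of Z₀, whose
amplitude is nonzero. -/
theorem hsPoly_ne_zero (N : ℕ) : hsPoly N ≠ 0 := by
  obtain ⟨Z₀, -, hZ₀⟩ := Finset.exists_subset_card_eq
    (s := (Finset.univ : Finset (Fin N))) (n := N / 2) (by simp; omega)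
  intro h
  have h1 := congrArg (eval (Sum.elim (fun α => if α ∈ Z₀ then (1 : ℂ) else 0)
    fun α => if α ∈ Z₀ then 0 else 1)) h
  rw [hsPoly_eq, map_sum, map_zero, Finset.sum_eq_single Z₀] at h1
  · rw [smul_eval, configPoly, map_mul, eval_prod, eval_prod, Finset.prod_eq_one,
      Finset.prod_eq_one, mul_one, mul_one] at h1
    · exact hsAmplitude_ne_zero Z₀ h1
    · intro α hα
      simpa using hα
    · intro α hα
      simpa using hα
  · intro Z hZ hne
    rw [Finset.mem_powersetCard_univ] at hZ
    obtain ⟨α, hα, hα'⟩ : ∃ α ∈ Z, α ∉ Z₀ := by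
      by_contra! hcon
      exact hne (Finset.eq_of_subset_of_card_le hcon (by omega))
    rw [smul_eval, configPoly, map_mul, eval_prod, Finset.prod_eq_zero hα (by simp [hα'])]
    simp
  · intro h
    exact absurd (Finset.mem_powersetCard_univ.2 hZ₀) h

end Fock

/-! ### From the Fock space to the states of the chain -/

section Fock

open MvPolynomial

variable {N : ℕ}

theorem occupation_inl {n : ℕ} (σ : Config N n) (α : Fin N) :
    occupation σ (Sum.inl α) = (σ α : ℕ) := rfl

theorem occupation_inr {n : ℕ} (σ : Config N n) (α : Fin N) :
    occupation σ (Sum.inr α) = n - (σ α : ℕ) := rfl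

theorem occupation_update_succ {n : ℕ} (σ : Config N n) (α : Fin N) {k l : Fin (n + 1)}
    (h : (l : ℕ) = (k : ℕ) + 1) :
    occupation (Function.update σ α k) + Finsupp.single (Sum.inl α) 1 =
      occupation (Function.update σ α l) + Finsupp.single (Sum.inr α) 1 := by
  ext i
  rcases i with β | β <;> rcases eq_or_ne β α with rfl | hβ
  · simp [occupation_inl, h]
  · simp [occupation_inl, Function.update_of_ne hβ, hβ.symm]
  · simp [occupation_inr, h]
    omega
  · simp [occupation_inr, Function.update_of_ne hβ, hβ.symm]

/-- `fockToState` as a linear map. -/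
def fockToStateLin (N n : ℕ) : Fock N →ₗ[ℂ] State N n where
  toFun := fockToState N n
  map_add' P Q := by
    ext σ
    simp [fockToState, add_mul]
  map_smul' c P := by
    ext σ
    simp [fockToState, mul_assoc]

theorem fockToStateLin_apply (n : ℕ) (P : Fock N) (σ : Config N n) : fockToStateLin N n P σ =
    P.coeff (occupation σ) * ((∏ α, Real.sqrt
      (((σ α : ℕ).factorial : ℝ) * ((n - (σ α : ℕ)).factorial : ℝ)) : ℝ) : ℂ) := rfl

theorem sqrt_mul_sqrt_factorial {n k : ℕ} (h : k + 1 ≤ n) :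
    √(((n : ℝ) - k) * ((k : ℝ) + 1)) * √((k.factorial : ℝ) * ((n - k).factorial : ℝ)) =
      ((n : ℝ) - k) * √(((k + 1).factorial : ℝ) * ((n - (k + 1)).factorial : ℝ)) := by
  have h1 : n - k = n - (k + 1) + 1 := by omega
  have h2 : (n : ℝ) - k = ((n - (k + 1) : ℕ) : ℝ) + 1 := by
    rw [Nat.cast_sub h]
    push_cast
    ring
  rw [h1, h2, Nat.factorial_succ, Nat.factorial_succ, ← Real.sqrt_mul (by positivity)]
  nth_rewrite 2 [← Real.sqrt_sq (by positivity : (0 : ℝ) ≤ ((n - (k + 1) : ℕ) : ℝ) + 1)]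
  rw [← Real.sqrt_mul (by positivity)]
  congr 1
  push_cast
  ring

theorem sqrt_mul_sqrt_factorial_succ {n k : ℕ} (h : k + 1 ≤ n) :
    √(((n : ℝ) - k) * ((k : ℝ) + 1)) *
        √(((k + 1).factorial : ℝ) * ((n - (k + 1)).factorial : ℝ)) =
      ((k : ℝ) + 1) * √((k.factorial : ℝ) * ((n - k).factorial : ℝ)) := by
  have h1 : n - k = n - (k + 1) + 1 := by omega
  have h2 : (n : ℝ) - k = ((n - (k + 1) : ℕ) : ℝ) + 1 := by
    rw [Nat.cast_sub h]
    push_cast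
    ring
  rw [h1, h2, Nat.factorial_succ, Nat.factorial_succ, ← Real.sqrt_mul (by positivity)]
  nth_rewrite 2 [← Real.sqrt_sq (by positivity : (0 : ℝ) ≤ (k : ℝ) + 1)]
  rw [← Real.sqrt_mul (by positivity)]
  congr 1
  push_cast
  ring

/-- The Schwinger representation S⁺ = a†b: the square root in the matrix element is exactly the
ratio of factorial normalizations, up to the integer produced by differentiation. -/
theorem siteOp_splusMat_mulVec (n : ℕ) (α : Fin N) (P : Fock N) :
    siteOp α (splusMat n) *ᵥ fockToStateLin N n P =
      fockToStateLin N n (X (Sum.inl α) * pderiv (Sum.inr α) P) := by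
  ext σ
  rw [siteOp_mulVec]
  rcases Nat.eq_zero_or_pos (σ α : ℕ) with hk | hk
  · rw [Finset.sum_eq_zero, fockToStateLin_apply, coeff_X_mul', if_neg, zero_mul]
    · rw [Finsupp.mem_support_iff, occupation_inl, hk]
      simp
    · intro l _
      rw [splusMat, Matrix.of_apply, if_neg (by omega), zero_mul]
  · obtain ⟨j, hj⟩ : ∃ j : Fin (n + 1), (σ α : ℕ) = (j : ℕ) + 1 :=
      ⟨⟨(σ α : ℕ) - 1, by omega⟩, by simp only; omega⟩
    have hjn : (j : ℕ) + 1 ≤ n := by omega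
    have hocc := occupation_update_succ σ α hj
    rw [Function.update_eq_self] at hocc
    rw [Finset.sum_eq_single j, splusMat, Matrix.of_apply, if_pos hj, fockToStateLin_apply,
      fockToStateLin_apply, coeff_X_mul', if_pos, coeff_pderiv]
    · have h1 : occupation σ - Finsupp.single (Sum.inl α) 1 + Finsupp.single (Sum.inr α) 1 =
          occupation (Function.update σ α j) := by
        rw [tsub_add_eq_add_tsub, ← hocc, add_tsub_cancel_right]
        rw [Finsupp.single_le_iff, occupation_inl]
        exact hk
      have h2 : (((occupation σ - Finsupp.single (Sum.inl α) 1 : (Fin N ⊕ Fin N) →₀ ℕ)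
          (Sum.inr α) : ℕ) : ℂ) + 1 =
          (n : ℂ) - (j : ℕ) := by
        rw [Finsupp.tsub_apply, occupation_inr, hj, Finsupp.single_eq_of_ne (by simp), Nat.sub_zero,
          Nat.cast_sub hjn]
        push_cast
        ring
      have h3 := sqrt_mul_sqrt_factorial hjn
      rw [h1, h2, ← Finset.mul_prod_erase _ _ (Finset.mem_univ α),
        ← Finset.mul_prod_erase _ (fun β => √(((σ β : ℕ).factorial : ℝ) * _))
          (Finset.mem_univ α), Function.update_self, hj]
      rw [Finset.prod_congr rfl fun β hβ => by
        rw [Function.update_of_ne (Finset.ne_of_mem_erase hβ)]]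
      have h4 := congrArg (fun x : ℝ => (x : ℂ)) h3
      simp only [Complex.ofReal_mul, Complex.ofReal_sub, Complex.ofReal_natCast] at h4 ⊢
      linear_combination (coeff (occupation (Function.update σ α j)) P *
        ((∏ β ∈ Finset.univ.erase α, √(((σ β : ℕ).factorial : ℝ) *
          ((n - (σ β : ℕ)).factorial : ℝ)) : ℝ) : ℂ)) * h4
    · rw [Finsupp.mem_support_iff, occupation_inl]
      omega
    · intro l _ hl
      rw [splusMat, Matrix.of_apply, if_neg fun h => hl (Fin.ext (by omega)), zero_mul]
    · simp

theorem siteOp_sminusMat_mulVec (n : ℕ) (α : Fin N) (P : Fock N) :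
    siteOp α (sminusMat n) *ᵥ fockToStateLin N n P =
      fockToStateLin N n (X (Sum.inr α) * pderiv (Sum.inl α) P) := by
  ext σ
  rw [siteOp_mulVec]
  by_cases hk : (σ α : ℕ) = n
  · rw [Finset.sum_eq_zero, fockToStateLin_apply, coeff_X_mul', if_neg, zero_mul]
    · rw [Finsupp.mem_support_iff, occupation_inr, hk]
      simp
    · intro l _
      rw [sminusMat, Matrix.conjTranspose_apply, splusMat, Matrix.of_apply, if_neg (by omega),
        star_zero, zero_mul]
  · obtain ⟨j, hj⟩ : ∃ j : Fin (n + 1), (j : ℕ) = (σ α : ℕ) + 1 :=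
      ⟨⟨(σ α : ℕ) + 1, by omega⟩, rfl⟩
    have hjn : (σ α : ℕ) + 1 ≤ n := by omega
    have hocc := occupation_update_succ σ α hj
    rw [Function.update_eq_self] at hocc
    rw [Finset.sum_eq_single j, sminusMat, Matrix.conjTranspose_apply, splusMat, Matrix.of_apply,
      if_pos hj, fockToStateLin_apply, fockToStateLin_apply, coeff_X_mul', if_pos, coeff_pderiv,
      Complex.star_def, Complex.conj_ofReal]
    · have h1 : occupation σ - Finsupp.single (Sum.inr α) 1 + Finsupp.single (Sum.inl α) 1 =
          occupation (Function.update σ α j) := by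
        rw [tsub_add_eq_add_tsub, hocc, add_tsub_cancel_right]
        rw [Finsupp.single_le_iff, occupation_inr]
        omega
      have h2 : (((occupation σ - Finsupp.single (Sum.inr α) 1 : (Fin N ⊕ Fin N) →₀ ℕ)
          (Sum.inl α) : ℕ) : ℂ) + 1 =
          (σ α : ℕ) + 1 := by
        rw [Finsupp.tsub_apply, occupation_inl, Finsupp.single_eq_of_ne (by simp), Nat.sub_zero]
      have h3 := sqrt_mul_sqrt_factorial_succ hjn
      rw [h1, h2, ← Finset.mul_prod_erase _ _ (Finset.mem_univ α),
        ← Finset.mul_prod_erase _ (fun β => √(((σ β : ℕ).factorial : ℝ) * _))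
          (Finset.mem_univ α), Function.update_self, hj]
      rw [Finset.prod_congr rfl fun β hβ => by
        rw [Function.update_of_ne (Finset.ne_of_mem_erase hβ)]]
      have h4 := congrArg (fun x : ℝ => (x : ℂ)) h3
      simp only [Complex.ofReal_mul, Complex.ofReal_add, Complex.ofReal_one,
        Complex.ofReal_natCast] at h4 ⊢
      linear_combination (coeff (occupation (Function.update σ α j)) P *
        ((∏ β ∈ Finset.univ.erase α, √(((σ β : ℕ).factorial : ℝ) *
          ((n - (σ β : ℕ)).factorial : ℝ)) : ℝ) : ℂ)) * h4
    · rw [Finsupp.mem_support_iff, occupation_inr]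
      omega
    · intro l _ hl
      rw [sminusMat, Matrix.conjTranspose_apply, splusMat, Matrix.of_apply,
        if_neg fun h => hl (Fin.ext (by omega)), star_zero, zero_mul]
    · simp

theorem siteOp_szMat_mulVec (n : ℕ) (α : Fin N) (P : Fock N) :
    siteOp α (szMat n) *ᵥ fockToStateLin N n P =
      fockToStateLin N n ((1 / 2 : ℂ) • (X (Sum.inl α) * pderiv (Sum.inl α) P
        - X (Sum.inr α) * pderiv (Sum.inr α) P)) := by
  ext σ
  rw [siteOp_mulVec, Finset.sum_eq_single (σ α)]
  · rw [Function.update_eq_self, fockToStateLin_apply, fockToStateLin_apply, coeff_smul, coeff_sub,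
      coeff_X_mul_pderiv, coeff_X_mul_pderiv, occupation_inl, occupation_inr, szMat,
      Matrix.diagonal_apply_eq, Nat.cast_sub (by omega), spin, smul_eq_mul]
    push_cast
    ring
  · intro l _ hl
    rw [szMat, Matrix.diagonal_apply_ne' _ hl, zero_mul]
  · simp

/-- With n bosons on each site, every monomial that occurs is the occupation of a configuration, and
the normalization factors are nonzero. -/
theorem fockToState_injective_of_fockNumber {n : ℕ} {P : Fock N}
    (hP : ∀ α, fockNumber (Pi.single α 1) P = (n : ℂ) • P) (h : fockToStateLin N n P = 0) :
    P = 0 := by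
  ext m
  rw [coeff_zero]
  by_cases hm : ∀ α, m (Sum.inl α) + m (Sum.inr α) = n
  · have hlt : ∀ α, m (Sum.inl α) < n + 1 := fun α => by have := hm α; omega
    have hocc : occupation (fun α => (⟨m (Sum.inl α), hlt α⟩ : Fin (n + 1))) = m := by
      ext i
      rcases i with α | α
      · rfl
      · rw [occupation_inr]
        have := hm α
        simp only
        omega
    have h1 := congrFun h fun α => (⟨m (Sum.inl α), hlt α⟩ : Fin (n + 1))
    rw [fockToStateLin_apply, hocc, Pi.zero_apply, mul_eq_zero] at h1
    refine h1.resolve_right ?_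
    rw [Complex.ofReal_eq_zero]
    positivity
  · push Not at hm
    obtain ⟨α, hα⟩ := hm
    have h1 := coeff_fockNumber_single α P m
    rw [hP, coeff_smul, smul_eq_mul] at h1
    have h2 : ((m (Sum.inl α) : ℂ) + m (Sum.inr α) - n) * coeff m P = 0 := by
      linear_combination -h1
    refine (mul_eq_zero.1 h2).resolve_left fun h3 => hα ?_
    rw [sub_eq_zero] at h3
    exact_mod_cast h3

end Fock

/-! ### The spin liquid state is annihilated by the operators `𝐃_α` -/

section Fock

open MvPolynomial

variable {N : ℕ}

/-- The vector operator `∑_β f_β 𝐒_β` on the Fock space. -/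
def fockSpin (f : Fin N → ℂ) : Fin 3 → Derivation ℂ (Fock N) (Fock N) :=
  ![(1 / 2 : ℂ) • (fockPlus f + fockMinus f), (-(Complex.I / 2)) • (fockPlus f - fockMinus f),
    fockZ f]

theorem fockSpin_zero (f : Fin N → ℂ) (P : Fock N) :
    fockSpin f 0 P = (1 / 2 : ℂ) • (fockPlus f P + fockMinus f P) := rfl

theorem fockSpin_one (f : Fin N → ℂ) (P : Fock N) :
    fockSpin f 1 P = (-(Complex.I / 2)) • (fockPlus f P - fockMinus f P) := rfl

theorem fockSpin_two (f : Fin N → ℂ) (P : Fock N) : fockSpin f 2 P = fockZ f P := rfl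

theorem sum_single_smul {M : Type*} [AddCommMonoid M] [Module ℂ M] (α : Fin N) (g : Fin N → M) :
    ∑ β, (Pi.single α (1 : ℂ) : Fin N → ℂ) β • g β = g α := by
  rw [Finset.sum_eq_single α]
  · simp
  · intro β _ h
    simp [h]
  · simp

theorem fockPlus_single (α : Fin N) (P : Fock N) :
    fockPlus (Pi.single α 1) P = X (Sum.inl α) * pderiv (Sum.inr α) P := by
  rw [fockPlus_eq_sum, sum_single_smul]

theorem fockMinus_single (α : Fin N) (P : Fock N) :
    fockMinus (Pi.single α 1) P = X (Sum.inr α) * pderiv (Sum.inl α) P := by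
  rw [fockMinus_eq_sum, sum_single_smul]

theorem fockZ_single (α : Fin N) (P : Fock N) : fockZ (Pi.single α 1) P = (1 / 2 : ℂ) •
    (X (Sum.inl α) * pderiv (Sum.inl α) P - X (Sum.inr α) * pderiv (Sum.inr α) P) := by
  rw [fockZ_eq_sum, sum_single_smul]

theorem fockSpin_eq_sum (f : Fin N → ℂ) (i : Fin 3) (P : Fock N) :
    fockSpin f i P = ∑ β, f β • fockSpin (Pi.single β 1) i P := by
  fin_cases i
  · change fockSpin f 0 P = ∑ β, f β • fockSpin (Pi.single β 1) 0 P
    simp only [fockSpin_zero, fockPlus_single, fockMinus_single, fockPlus_eq_sum f,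
      fockMinus_eq_sum f, ← Finset.sum_add_distrib, Finset.smul_sum]
    exact Finset.sum_congr rfl fun β _ => by module
  · change fockSpin f 1 P = ∑ β, f β • fockSpin (Pi.single β 1) 1 P
    simp only [fockSpin_one, fockPlus_single, fockMinus_single, fockPlus_eq_sum f,
      fockMinus_eq_sum f, ← Finset.sum_sub_distrib, Finset.smul_sum]
    exact Finset.sum_congr rfl fun β _ => by module
  · change fockSpin f 2 P = ∑ β, f β • fockSpin (Pi.single β 1) 2 P
    simp only [fockSpin_two, fockZ_single, fockZ_eq_sum f]

theorem siteSpin_mulVec (n : ℕ) (α : Fin N) (i : Fin 3) (P : Fock N) :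
    siteSpin N n α i *ᵥ fockToStateLin N n P =
      fockToStateLin N n (fockSpin (Pi.single α 1) i P) := by
  fin_cases i
  · change siteOp α (spinMat n 0) *ᵥ _ = fockToStateLin N n (fockSpin _ 0 P)
    rw [spinMat_zero, ← siteAlgHom_apply, map_smul, map_add, siteAlgHom_apply, siteAlgHom_apply,
      Matrix.smul_mulVec, Matrix.add_mulVec, siteOp_splusMat_mulVec, siteOp_sminusMat_mulVec,
      fockSpin_zero, map_smul, map_add, fockPlus_single, fockMinus_single]
  · change siteOp α (spinMat n 1) *ᵥ _ = fockToStateLin N n (fockSpin _ 1 P)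
    rw [spinMat_one, ← siteAlgHom_apply, map_smul, map_sub, siteAlgHom_apply, siteAlgHom_apply,
      Matrix.smul_mulVec, Matrix.sub_mulVec, siteOp_splusMat_mulVec, siteOp_sminusMat_mulVec,
      fockSpin_one, map_smul, map_sub, fockPlus_single, fockMinus_single]
  · change siteOp α (spinMat n 2) *ᵥ _ = fockToStateLin N n (fockSpin _ 2 P)
    rw [spinMat_two, siteOp_szMat_mulVec, fockSpin_two, fockZ_single]

theorem thetaSpin_mulVec (n : ℕ) (α : Fin N) (i : Fin 3) (P : Fock N) :
    thetaSpin N n α i *ᵥ fockToStateLin N n P =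
      fockToStateLin N n (fockSpin (theta N α) i P) := by
  rw [fockSpin_eq_sum, map_sum, thetaSpin, Matrix.sum_mulVec]
  simp only [Matrix.smul_mulVec, siteSpin_mulVec, map_smul]

theorem totalSpin_mulVec (n : ℕ) (i : Fin 3) (P : Fock N) :
    totalSpin N n i *ᵥ fockToStateLin N n P = fockToStateLin N n (fockSpin 1 i P) := by
  rw [fockSpin_eq_sum, map_sum, totalSpin, Finset.sum_apply, Matrix.sum_mulVec]
  simp only [siteSpin_mulVec, Pi.one_apply, one_smul]

theorem psi0_eq (N n : ℕ) : psi0 N n = fockToStateLin N n (hsPoly N ^ n) := rfl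

open scoped ComplexOrder in
-- From S⁻Ψ = 0 and S^zΨ = 0 one gets S⁻S⁺Ψ = S⁺S⁻Ψ − 2S^zΨ = 0, hence ‖S⁺Ψ‖² = 0. The norm is that
-- of the spin-1/2 chain, into which polynomials with one boson per site embed.
theorem fockPlus_one_hsPoly (hN : 1 ≤ N) (he : Even N) : fockPlus 1 (hsPoly N) = 0 := by
  have hplus : ∀ P : Fock N, (∑ α, siteOp α (sminusMat 1) : Op N 1)ᴴ *ᵥ fockToStateLin N 1 P =
      fockToStateLin N 1 (fockPlus 1 P) := by
    intro P
    simp only [Matrix.conjTranspose_sum, siteOp_conjTranspose, sminusMat,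
      Matrix.conjTranspose_conjTranspose, Matrix.sum_mulVec, siteOp_splusMat_mulVec,
      fockPlus_eq_sum, map_sum, Pi.one_apply, one_smul]
  have hminus : ∀ P : Fock N, (∑ α, siteOp α (sminusMat 1) : Op N 1) *ᵥ fockToStateLin N 1 P =
      fockToStateLin N 1 (fockMinus 1 P) := by
    intro P
    simp only [Matrix.sum_mulVec, siteOp_sminusMat_mulVec,
      fockMinus_eq_sum, map_sum, Pi.one_apply, one_smul]
  refine fockToState_injective_of_fockNumber (n := 1) (fun α => ?_) ?_
  · rw [fockNumber_fockPlus, fockNumber_hsPoly, Nat.cast_one, one_smul]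
  · rw [← hplus, ← Matrix.conjTranspose_mul_self_mulVec_eq_zero, Matrix.conjTranspose_conjTranspose,
      ← Matrix.mulVec_mulVec, hplus, hminus]
    have h := fockPlus_fockMinus 1 1 (hsPoly N)
    rw [fockMinus_one_hsPoly hN he, mul_one, fockZ_one_hsPoly he, map_zero, smul_zero,
      add_zero] at h
    rw [← h, map_zero]

/-- The operator on the left is a first-order differential operator W, so W(Ψⁿ) = nΨⁿ⁻¹ WΨ; this
carries the spin-1/2 case over to all spins. -/
theorem hsPoly_multiplet (hN : 1 ≤ N) (he : Even N) (n : ℕ) (α : Fin N) :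
    X (Sum.inl α) ^ 2 * fockMinus (theta N α) (hsPoly N ^ n)
      - X (Sum.inr α) ^ 2 * fockPlus (theta N α) (hsPoly N ^ n)
      - 2 * X (Sum.inl α) * X (Sum.inr α) * fockZ (theta N α) (hsPoly N ^ n) = 0 := by
  have h := spin_multiplet_eq_zero (theta_self α) (fockNumber_hsPoly α)
    (fockPlus_one_hsPoly hN he) (fockMinus_theta_pderiv_hsPoly hN he α)
  simp only [Derivation.leibniz_pow, smul_eq_mul, nsmul_eq_mul]
  linear_combination (n : Fock N) * hsPoly N ^ (n - 1) * h

theorem fockNumber_hsPoly_pow (n : ℕ) (α : Fin N) :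
    fockNumber (Pi.single α 1) (hsPoly N ^ n) = (n : ℂ) • hsPoly N ^ n := by
  rw [Derivation.leibniz_pow, fockNumber_hsPoly, smul_eq_mul]
  rcases Nat.eq_zero_or_pos n with rfl | hn
  · simp
  · rw [pow_sub_one_mul hn.ne', Nat.cast_smul_eq_nsmul]

/-- If the part of highest spin of the coupling of a vector `(p, m, z)` with the bosons of a site
vanishes, then so does its image under the corresponding projection. -/
theorem projection_eq_zero {A : Type*} [CommRing A] [Algebra ℂ A] (da db : Derivation ℂ A A)
    {a b p m z : A} {n : ℕ} (haa : da a = 1) (hab : da b = 0) (hba : db a = 0) (hbb : db b = 1)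
    (hcomm : ∀ x, db (da x) = da (db x))
    (hp : a * da p + b * db p = n * p) (hm : a * da m + b * db m = n * m)
    (hz : a * da z + b * db z = n * z) (hW : a ^ 2 * m - b ^ 2 * p - 2 * a * b * z = 0) :
    ((2 * (n + 2) : ℂ) • (a * db z) - (n + 2 : ℂ) • (a * da p - b * db p) + ((n + 2) ^ 2 : ℂ) • p
      - (2 : ℂ) • (a * db (a * db m + b * da p + (a * da z - b * db z))) = 0) ∧
    (-(2 * (n + 2) : ℂ) • (b * da z) + (n + 2 : ℂ) • (a * da m - b * db m) + ((n + 2) ^ 2 : ℂ) • m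
      - (2 : ℂ) • (b * da (a * db m + b * da p + (a * da z - b * db z))) = 0) ∧
    ((n + 2 : ℂ) • (b * da p - a * db m) + ((n + 2) ^ 2 : ℂ) • z
      - (a * da (a * db m + b * da p + (a * da z - b * db z))
        - b * db (a * db m + b * da p + (a * da z - b * db z))) = 0) := by
  simp only [Algebra.smul_def, map_mul, map_neg, map_pow, map_add, map_natCast, map_ofNat]
  have h2a : da (2 : A) = 0 := Derivation.map_natCast da 2
  have h2b : db (2 : A) = 0 := Derivation.map_natCast db 2
  have hda := fun {x y : A} (h : x = y) => congrArg da h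
  have hdb := fun {x y : A} (h : x = y) => congrArg db h
  have hpa := hda hp
  have hpb := hdb hp
  have hma := hda hm
  have hmb := hdb hm
  have hza := hda hz
  have hzb := hdb hz
  have hWaa := hda (hda hW)
  have hWab := hda (hdb hW)
  have hWbb := hdb (hdb hW)
  simp only [map_add, map_sub, map_zero, Derivation.leibniz, Derivation.leibniz_pow,
    Derivation.map_natCast, haa, hab, hba, hbb, hcomm, h2a, h2b, smul_eq_mul, nsmul_eq_mul,
    mul_zero, mul_one, add_zero, zero_add, pow_one, Nat.cast_ofNat, Nat.add_one_sub_one] at hpa hpb hma hmb hza hzb hWaa hWab hWbb ⊢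
  -- The +, − and z components come from ∂_b², ∂_a² and ∂_a∂_b of the vanishing polynomial,
  -- corrected by Euler's homogeneity relations and their derivatives.
  refine ⟨?_, ?_, ?_⟩
  · linear_combination -((n : A) + 4) * hp - 2 * b * hpb - 2 * a * hzb - 2 * hWbb
  · linear_combination -((n : A) + 4) * hm - 2 * a * hma + 2 * b * hza + 2 * hWaa
  · linear_combination -b * hpa + a * hmb - a * hza - b * hzb - ((n : A) + 4) * hz - 2 * hWab

theorem dOp_mulVec (n : ℕ) (α : Fin N) (i : Fin 3) (P : Fock N) :
    dOp N n α i *ᵥ fockToStateLin N n P = fockToStateLin N n ((1 / 2 : ℂ) •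
      (Complex.I • (fockSpin (Pi.single α 1) (i + 1) (fockSpin (theta N α) (i + 2) P)
          - fockSpin (Pi.single α 1) (i + 2) (fockSpin (theta N α) (i + 1) P))
        + ((spin n : ℂ) + 1) • fockSpin (theta N α) i P
        - (1 / ((spin n : ℂ) + 1)) • fockSpin (Pi.single α 1) i
            (∑ j, fockSpin (Pi.single α 1) j (fockSpin (theta N α) j P)))) := by
  simp only [dOp_eq, crossOp, Matrix.smul_mulVec, Matrix.add_mulVec, Matrix.sub_mulVec,
    ← Matrix.mulVec_mulVec, Matrix.sum_mulVec, thetaSpin_mulVec, siteSpin_mulVec, ← map_sum]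
  simp only [map_smul, map_add, map_sub]

theorem dOp_mulVec_psi0 (hN : 1 ≤ N) (he : Even N) (n : ℕ) (α : Fin N) (i : Fin 3) :
    dOp N n α i *ᵥ psi0 N n = 0 := by
  have hnum : ∀ x : Fock N, fockNumber (Pi.single α 1) x = (n : ℂ) • x →
      X (Sum.inl α) * pderiv (Sum.inl α) x + X (Sum.inr α) * pderiv (Sum.inr α) x =
        (n : Fock N) * x := by
    intro x hx
    rw [← fockNumber_single, hx, Algebra.smul_def, map_natCast]
  obtain ⟨hp, hm, hz⟩ := projection_eq_zero (pderiv (Sum.inl α)) (pderiv (Sum.inr α))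
    (a := X (Sum.inl α)) (b := X (Sum.inr α)) (p := fockPlus (theta N α) (hsPoly N ^ n))
    (m := fockMinus (theta N α) (hsPoly N ^ n)) (z := fockZ (theta N α) (hsPoly N ^ n)) (n := n)
    (pderiv_X_self _) (pderiv_X_of_ne (by simp)) (pderiv_X_of_ne (by simp)) (pderiv_X_self _)
    (fun x => pderiv_pderiv_comm _ _ x)
    (hnum _ (by rw [fockNumber_fockPlus, fockNumber_hsPoly_pow, Derivation.map_smul]))
    (hnum _ (by rw [fockNumber_fockMinus, fockNumber_hsPoly_pow, Derivation.map_smul]))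
    (hnum _ (by rw [fockNumber_fockZ, fockNumber_hsPoly_pow, Derivation.map_smul]))
    (hsPoly_multiplet hN he n α)
  have hQ : ∑ j, fockSpin (Pi.single α 1) j (fockSpin (theta N α) j (hsPoly N ^ n)) =
      (1 / 2 : ℂ) • (X (Sum.inl α) * pderiv (Sum.inr α) (fockMinus (theta N α) (hsPoly N ^ n))
        + X (Sum.inr α) * pderiv (Sum.inl α) (fockPlus (theta N α) (hsPoly N ^ n))
        + (X (Sum.inl α) * pderiv (Sum.inl α) (fockZ (theta N α) (hsPoly N ^ n))
          - X (Sum.inr α) * pderiv (Sum.inr α) (fockZ (theta N α) (hsPoly N ^ n)))) := by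
    simp only [Fin.sum_univ_three, fockSpin_zero, fockSpin_one, fockSpin_two, fockPlus_single,
      fockMinus_single, fockZ_single, Derivation.map_smul, map_add, map_sub]
    match_scalars <;> ring_nf <;> simp [Complex.I_sq] <;> norm_num
  rw [psi0_eq, dOp_mulVec, hQ]
  have hn : (n : ℂ) + 2 ≠ 0 := by exact_mod_cast (by omega : n + 2 ≠ 0)
  -- The relations `hp`, `hm`, `hz` are the bracket in D_α multiplied by 2(n+2) = 4(S+1), which
  -- clears the denominators; the Cartesian components below divide this out again.
  have hs : (spin n : ℂ) + 1 = ((n : ℂ) + 2) / 2 := by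
    rw [spin]
    push_cast
    ring
  rw [hs]
  set Q := X (Sum.inl α) * pderiv (Sum.inr α) (fockMinus (theta N α) (hsPoly N ^ n))
        + X (Sum.inr α) * pderiv (Sum.inl α) (fockPlus (theta N α) (hsPoly N ^ n))
        + (X (Sum.inl α) * pderiv (Sum.inl α) (fockZ (theta N α) (hsPoly N ^ n))
          - X (Sum.inr α) * pderiv (Sum.inr α) (fockZ (theta N α) (hsPoly N ^ n)))
  clear_value Q
  refine (congrArg _ (congrArg _ ?_)).trans ((congrArg _ (smul_zero (1 / 2 : ℂ))).trans (map_zero _))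
  fin_cases i
  · change Complex.I • (fockSpin (Pi.single α 1) 1 (fockSpin (theta N α) 2 _) -
      fockSpin (Pi.single α 1) 2 (fockSpin (theta N α) 1 _)) +
        (((n : ℂ) + 2) / 2) • fockSpin (theta N α) 0 _ -
        (1 / (((n : ℂ) + 2) / 2)) • fockSpin (Pi.single α 1) 0 ((1 / 2 : ℂ) • Q) = 0
    simp only [fockSpin_zero, fockSpin_one, fockSpin_two, fockPlus_single, fockMinus_single,
      fockZ_single, Derivation.map_smul, map_sub]
    linear_combination (norm := skip) (1 / (4 * ((n : ℂ) + 2))) • hp + (1 / (4 * ((n : ℂ) + 2))) • hm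
    match_scalars <;> field_simp <;> ring_nf <;> simp [Complex.I_sq]
  · change Complex.I • (fockSpin (Pi.single α 1) 2 (fockSpin (theta N α) 0 _) -
      fockSpin (Pi.single α 1) 0 (fockSpin (theta N α) 2 _)) +
        (((n : ℂ) + 2) / 2) • fockSpin (theta N α) 1 _ -
        (1 / (((n : ℂ) + 2) / 2)) • fockSpin (Pi.single α 1) 1 ((1 / 2 : ℂ) • Q) = 0
    simp only [fockSpin_zero, fockSpin_one, fockSpin_two, fockPlus_single, fockMinus_single,
      fockZ_single, Derivation.map_smul, map_add]
    linear_combination (norm := skip) (-(Complex.I / (4 * ((n : ℂ) + 2)))) • hp + (Complex.I / (4 * ((n : ℂ) + 2))) • hm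
    match_scalars <;> field_simp <;> ring_nf
  · change Complex.I • (fockSpin (Pi.single α 1) 0 (fockSpin (theta N α) 1 _) -
      fockSpin (Pi.single α 1) 1 (fockSpin (theta N α) 0 _)) +
        (((n : ℂ) + 2) / 2) • fockSpin (theta N α) 2 _ -
        (1 / (((n : ℂ) + 2) / 2)) • fockSpin (Pi.single α 1) 2 ((1 / 2 : ℂ) • Q) = 0
    simp only [fockSpin_zero, fockSpin_one, fockSpin_two, fockPlus_single, fockMinus_single,
      fockZ_single, Derivation.map_smul, map_add, map_sub]
    linear_combination (norm := skip) (1 / (2 * ((n : ℂ) + 2))) • hz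
    match_scalars <;> field_simp <;> ring_nf <;> simp [Complex.I_sq]

theorem totalSpin_mulVec_psi0 (hN : 1 ≤ N) (he : Even N) (n : ℕ) (i : Fin 3) :
    totalSpin N n i *ᵥ psi0 N n = 0 := by
  have h1 := fockPlus_one_hsPoly hN he
  have h2 := fockMinus_one_hsPoly hN he
  have h3 := fockZ_one_hsPoly he
  rw [psi0_eq, totalSpin_mulVec, Derivation.leibniz_pow]
  have h : fockSpin 1 i (hsPoly N) = 0 := by
    fin_cases i
    · exact (fockSpin_zero _ _).trans (by rw [h1, h2]; simp)
    · exact (fockSpin_one _ _).trans (by rw [h1, h2]; simp)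
    · exact (fockSpin_two _ _).trans h3
  rw [h, smul_zero, smul_zero, map_zero]

theorem psi0_ne_zero (N n : ℕ) : psi0 N n ≠ 0 := by
  rw [psi0_eq]
  intro h
  exact pow_ne_zero n (hsPoly_ne_zero N)
    (fockToState_injective_of_fockNumber (fun α => fockNumber_hsPoly_pow n α) h)

end Fock

/-! ### The ground state -/

section GroundState

open scoped ComplexOrder

theorem posSemidef_totalSpin_dot (N n : ℕ) : (totalSpin N n ⬝ᵥ totalSpin N n).PosSemidef := by
  have h : ∀ i, (totalSpin N n i)ᴴ = totalSpin N n i := by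
    intro i
    simp only [totalSpin, Finset.sum_apply, Matrix.conjTranspose_sum, siteSpin_conjTranspose]
  refine Matrix.posSemidef_sum _ fun i _ => ?_
  have h' := Matrix.posSemidef_conjTranspose_mul_self (totalSpin N n i)
  rwa [h] at h'

/-- By the operator identity this is a combination of terms D†D and S_tot²; the bound on N makes the
coefficient N−2 nonnegative. -/
theorem posSemidef_hTilde_sub (N n : ℕ) (hN : 2 ≤ N) :
    (hTilde N n - ((eTilde N n : ℝ) : ℂ) • (1 : Op N n)).PosSemidef := by
  have hN' : (2 : ℝ) ≤ N := by exact_mod_cast hN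
  have hs : (0 : ℝ) ≤ spin n := by rw [spin]; positivity
  rw [← operator_identity N n (by omega)]
  refine Matrix.PosSemidef.smul (Matrix.PosSemidef.add (Matrix.PosSemidef.smul
    (Matrix.posSemidef_sum _ fun α _ => Matrix.posSemidef_sum _ fun i _ =>
      Matrix.posSemidef_conjTranspose_mul_self _) ?_)
    (Matrix.PosSemidef.smul (posSemidef_totalSpin_dot N n) ?_)) ?_
  · exact Complex.zero_le_real.2 (by positivity)
  · exact Complex.zero_le_real.2 (div_nonneg (mul_nonneg (by positivity) (by linarith))
      (by positivity))
  · exact Complex.zero_le_real.2 (by positivity)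

theorem isGroundState_of_posSemidef {N n : ℕ} {H : Op N n} {E : ℝ} {v : State N n}
    (hH : (H - ((E : ℝ) : ℂ) • (1 : Op N n)).PosSemidef) (hv : v ≠ 0)
    (hE : (H - ((E : ℝ) : ℂ) • (1 : Op N n)) *ᵥ v = 0) : IsGroundState H E v := by
  refine ⟨?_, hv, ?_, fun μ hμ => ?_⟩
  · have h1 := hH.isHermitian.add (Matrix.isHermitian_one (n := Config N n) (α := ℂ) |>.smul
      (k := ((E : ℝ) : ℂ)) (Complex.conj_ofReal E))
    rwa [sub_add_cancel] at h1
  · rwa [Matrix.sub_mulVec, sub_eq_zero, Matrix.smul_mulVec, Matrix.one_mulVec] at hE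
  · obtain ⟨w, hw⟩ := hμ.exists_hasEigenvector
    have h1 : H *ᵥ w = (μ : ℂ) • w := by
      have := hw.apply_eq_smul
      rwa [Matrix.toLin'_apply] at this
    have h2 := hH.dotProduct_mulVec_nonneg w
    rw [Matrix.sub_mulVec, Matrix.smul_mulVec, Matrix.one_mulVec, h1, ← sub_smul,
      dotProduct_smul, ← Complex.ofReal_sub, smul_eq_mul] at h2
    have h3 : 0 < star w ⬝ᵥ w := Matrix.dotProduct_star_self_pos_iff.2 hw.2
    have h4 : (0 : ℂ) ≤ ((μ - E : ℝ) : ℂ) := le_of_mul_le_mul_right (by simpa using h2) h3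
    linarith [Complex.zero_le_real.1 h4]

end GroundState

end SpinChain

end

theorem mainTheorem5 (N n : ℕ) (hN : 1 ≤ N) :
    (((2 * Real.pi ^ 2 / (N : ℝ) ^ 2 : ℝ) : ℂ) •
        (((1 / ((2 * SpinChain.spin n + 1) * (2 * SpinChain.spin n + 3)) : ℝ) : ℂ) •
            ∑ α, SpinChain.dDaggerD N n α
          + (((SpinChain.spin n + 1) * ((N : ℝ) - 2) / (4 * (2 * SpinChain.spin n + 3)) : ℝ) : ℂ) •
            (SpinChain.totalSpin N n ⬝ᵥ SpinChain.totalSpin N n))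
      = SpinChain.hTilde N n - ((SpinChain.eTilde N n : ℝ) : ℂ) • (1 : SpinChain.Op N n)) ∧
    (Even N →
      SpinChain.IsGroundState (SpinChain.hTilde N n) (SpinChain.eTilde N n)
        (SpinChain.psi0 N n)) := by
  refine ⟨SpinChain.operator_identity N n hN, fun he => ?_⟩
  have hN2 : 2 ≤ N := by
    obtain ⟨M, hM⟩ := he
    omega
  refine SpinChain.isGroundState_of_posSemidef (SpinChain.posSemidef_hTilde_sub N n hN2)
    (SpinChain.psi0_ne_zero N n) ?_
  -- Every term on the positive side of the identity ends in some D_α or a component of S_tot, each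
  -- of which annihilates the state.
  rw [← SpinChain.operator_identity N n hN]
  simp only [Matrix.smul_mulVec, Matrix.add_mulVec, Matrix.sum_mulVec, SpinChain.dDaggerD,
    dotProduct, ← Matrix.mulVec_mulVec, SpinChain.dOp_mulVec_psi0 hN he,
    SpinChain.totalSpin_mulVec_psi0 hN he, Matrix.mulVec_zero, Finset.sum_const_zero, smul_zero,
    add_zero]
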